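/- Let $K$ be an algebraically closed field, let $s,m,d,r,u$ be nonnegative integers with $u,d\ge 1$, put $g=u(s+1)$ and $r_2=s-d+r$, and assume that $0\le r_2<s$ and $$\rho=g-(s+1)(s+g-m)=0,\qquad \mu=d-r(s+1-d+r)=0 .$$ Let $X=E_1\cup\dots\cup E_g$ be a general chain of elliptic curves over $K$: every $E_j$ is marked in two points $p_{(j)},q_{(j)}$ whose difference is nontorsion in $\mathrm{Pic}^0(E_j)$, and $q_{(j)}$ is glued to $p_{(j+1)}$ for $1\le j<g$ (these are the points of attachment). A limit $g^r_m$ on $X$ (Eisenbud–Harris) consists of a linear series $(L_j,V_j)$ of degree $m$ and dimension $r$ on each $E_j$, such that at each node the vanishing sequences satisfy $b^{(j)}_{r-i}(q_{(j)})+a^{(j+1)}_{i}(p_{(j+1)})\ge m$ for $0\le i\le r$. A limit $g^s_m$ has word type $w_1w_2\cdots w_g$, with $w_j\in\{1,\dots,s+1\}$, if for every $j$ the vanishing sequences $a_0<\dots<a_s$ at $p_{(j)}$ and $b_0<\dots<b_s$ at $q_{(j)}$ of its aspect on $E_j$ satisfy $a_{i}+b_{s-i}=m$ for $i=w_j-1$.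 Consider an inclusion of limit linear series $$g^{s-d+r}_{m-d}+p_1+\dots+p_d\hookrightarrow g^s_m$$ on $X$, i.e. a limit $g^s_m$ $(L_j,V_j)_j$, a limit $g^{r_2}_m$ $(L_j,V'_j)_j$ with $V'_j\subseteq V_j$ for all $j$, and effective divisors $D_j$ on $E_j$ with $\sum_j\deg D_j=d$ and $V'_j\subseteq H^0(E_j,L_j(-D_j))$; the points of the $D_j$, with multiplicities, are the base points $p_1,\dots,p_d$. Suppose that no base point is a point of attachment of $X$ and that the ambient $g^s_m$ has word type $(12\cdots(s+1))^u$ (the word $12\cdots(s+1)$ repeated $u$ times). Then on each component $E_j$ there lies at most one base point, and it is simple: $D_j=0$ or $D_j=P$ for a single point $P\in E_j$. -/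

import Mathlib

noncomputable section

namespace SecantChain

/-! ### Smooth projective curves through their function fields -/

section Curve

variable (K F : Type*) [Field K] [Field F] [Algebra K F]

/-- A place of the function field `F` over the algebraically closed field `K`, that is, a closed
point of the smooth projective curve with function field `F`: a normalized discrete valuation of
`F` that is trivial on the constants `K`. The value `ord f` is the order of vanishing of the
rational function `f` at the point (negative at a pole, `⊤` for `f = 0`). -/
structure Place where
  /-- order of vanishing of a rational function -/
  ord : AddValuation F (WithTop ℤ)
  normalized : ∀ n : ℤ, ∃ f : F, ord f = (n : WithTop ℤ)
  trivial_on_constants : ∀ c : K, c ≠ 0 → ord (algebraMap K F c) = 0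

/-- Divisors on the smooth projective curve with function field `F`. -/
abbrev CurveDivisor : Type _ := Place K F →₀ ℤ

variable {K F}

/-- The degree of a divisor (all residue fields are `K`). -/
def CurveDivisor.degree (D : CurveDivisor K F) : ℤ := D.sum fun _ n => n

/-- `D` is the divisor of a nonzero rational function, i.e. `D` is linearly equivalent to `0`. -/
def CurveDivisor.IsPrincipal (D : CurveDivisor K F) : Prop :=
  ∃ f : F, f ≠ 0 ∧ ∀ P : Place K F, P.ord f = ((D P : ℤ) : WithTop ℤ)

/-- The space `H⁰(𝒪(D))` of global sections of the line bundle `𝒪(D)`: the rational functions `f`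
with `div f + D ≥ 0`. -/
def CurveDivisor.sections (D : CurveDivisor K F) : Submodule K F where
  carrier := {f | ∀ P : Place K F, ((-(D P) : ℤ) : WithTop ℤ) ≤ P.ord f}
  zero_mem' := fun P => by rw [AddValuation.map_zero]; exact le_top
  add_mem' := fun {f h} hf hh P => AddValuation.map_le_add P.ord (hf P) (hh P)
  smul_mem' := fun c f hf P => by
    rcases eq_or_ne c 0 with rfl | hc
    · rw [zero_smul, AddValuation.map_zero]; exact le_top
    · rw [Algebra.smul_def, AddValuation.map_mul, P.trivial_on_constants c hc, zero_add]
      exact hf P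

variable (K F) in
/-- A linear series `g^r_m`: a line bundle of degree `m`, given as `𝒪(A)` for a divisor `A`, and an
`(r+1)`-dimensional space `V` of its global sections. -/
structure LinearSeries (r m : ℕ) where
  /-- the line bundle is `𝒪(A)` -/
  A : CurveDivisor K F
  degree_eq : A.degree = m
  /-- the space of sections -/
  V : Submodule K F
  le_sections : V ≤ A.sections
  finrank_eq : Module.finrank K V = r + 1

/-- `k` is the order of vanishing at `P` of some nonzero section in the series; a section `f` of
`𝒪(A)` vanishes to order `ord_P f + A P` at `P`. -/
def LinearSeries.IsVanishingOrder {r m : ℕ} (S : LinearSeries K F r m) (P : Place K F) (k : ℕ) :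
    Prop :=
  ∃ f ∈ S.V, P.ord f = (((k : ℤ) - S.A P : ℤ) : WithTop ℤ)

/-- The vanishing sequence `a_0 < a_1 < ⋯ < a_r` of the series at `P`: `S.van P i` is the `i`-th
smallest (counting from `0`) of the `r + 1` orders of vanishing at `P` of nonzero sections. -/
def LinearSeries.van {r m : ℕ} (S : LinearSeries K F r m) (P : Place K F) (i : ℕ) : ℕ :=
  Nat.nth (S.IsVanishingOrder P) i

end Curve

/-! ### Chains of elliptic curves -/

/-- `F` is the function field of an elliptic curve over `K`, that is, of a smooth Weierstrass
curve. -/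
def IsEllipticFunctionField (K F : Type*) [Field K] [Field F] [Algebra K F] : Prop :=
  ∃ W : WeierstrassCurve K, W.IsElliptic ∧ Nonempty (F ≃ₐ[K] W.toAffine.FunctionField)

/-- A chain `X = E_0 ∪ ⋯ ∪ E_{g-1}` of elliptic curves over `K`, where `E_j` is the smooth
projective curve with function field `F j`. Each component carries two marked points `p j` and
`q j`; the point `q j` of `E_j` is glued to the point `p (j+1)` of `E_{j+1}` to form a node. (Thus
the first `p` and the last `q` are marked smooth points of `X`, and all other marked points are
points of attachment.) -/
structure EllipticChain (K : Type*) [Field K] {g : ℕ} (F : Fin g → Type*) [∀ j, Field (F j)]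
    [∀ j, Algebra K (F j)] where
  isElliptic : ∀ j, IsEllipticFunctionField K (F j)
  /-- the first marked point of each component -/
  p : ∀ j, Place K (F j)
  /-- the second marked point of each component -/
  q : ∀ j, Place K (F j)
  p_ne_q : ∀ j, p j ≠ q j

section Chain

variable {K : Type*} [Field K] {g : ℕ} {F : Fin g → Type*} [∀ j, Field (F j)]
  [∀ j, Algebra K (F j)]

/-- The chain is general: on every component, the difference `p - q` of the marked points is
nontorsion in the divisor class group. -/
def EllipticChain.IsGeneral (X : EllipticChain K F) : Prop :=
  ∀ j : Fin g, ∀ k : ℕ, 0 < k →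
    ¬ CurveDivisor.IsPrincipal
      (Finsupp.single (X.p j) (k : ℤ) - Finsupp.single (X.q j) (k : ℤ) :
        CurveDivisor K (F j))

/-- A point of the `j`-th component is a point of attachment, i.e. a node of the chain. -/
def EllipticChain.IsNode (X : EllipticChain K F) (j : Fin g) (P : Place K (F j)) : Prop :=
  (0 < (j : ℕ) ∧ P = X.p j) ∨ ((j : ℕ) + 1 < g ∧ P = X.q j)

/-- A limit `g^r_m` on the chain in the sense of Eisenbud and Harris: a `g^r_m` on each component,
such that at each node the vanishing sequences of the two aspects, one written increasingly and the
other decreasingly, add up to at least `(m, …, m)`. -/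
structure LimitLinearSeries (X : EllipticChain K F) (r m : ℕ) where
  /-- the aspect on each component -/
  aspect : ∀ j, LinearSeries K (F j) r m
  compatible : ∀ j j' : Fin g, (j' : ℕ) = j + 1 → ∀ i ≤ r,
    m ≤ (aspect j).van (X.q j) (r - i) + (aspect j').van (X.p j') i

/-- The limit series has word type `w`: on the `j`-th component, `w j` is the index `i` (counted
from `0`) for which the vanishing orders `a_i` at `p j` and `b_{r-i}` at `q j` have the total `m`,
i.e. the index whose vanishing order does not increase from `p j` to `p (j+1)`. -/
def LimitLinearSeries.HasWordType {X : EllipticChain K F} {r m : ℕ}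
    (S : LimitLinearSeries X r m) (w : Fin g → Fin (r + 1)) : Prop :=
  ∀ j, (S.aspect j).van (X.p j) (w j) + (S.aspect j).van (X.q j) (r - w j) = m

/-- The cyclic word `12⋯(r+1)12⋯(r+1)⋯`, with the letter `k` represented by the index `k - 1`. -/
def cyclicWord (g r : ℕ) (j : Fin g) : Fin (r + 1) :=
  ⟨(j : ℕ) % (r + 1), Nat.mod_lt _ r.succ_pos⟩

/-- An inclusion of limit linear series `g^{r₂}_{m-d} + p_1 + ⋯ + p_d ↪ g^{r₁}_m` on the chain, none
of whose base points `p_1, …, p_d` is a point of attachment. The sum of the base points that lie on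
the `j`-th component (with multiplicities) is the effective divisor `base j`. -/
structure InclusionOffNodes (X : EllipticChain K F) (r₁ r₂ m d : ℕ) where
  /-- the ambient limit series -/
  ambient : LimitLinearSeries X r₁ m
  /-- the included limit series, with its base points -/
  included : LimitLinearSeries X r₂ m
  same_bundle : ∀ j, (included.aspect j).A = (ambient.aspect j).A
  le_ambient : ∀ j, (included.aspect j).V ≤ (ambient.aspect j).V
  /-- the base points on each component -/
  base : ∀ j, CurveDivisor K (F j)
  base_effective : ∀ j, 0 ≤ base j
  base_degree : ∑ j, (base j).degree = d
  vanishes_on_base : ∀ j,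
    (included.aspect j).V ≤ CurveDivisor.sections ((included.aspect j).A - base j)
  base_off_nodes : ∀ j P, X.IsNode j P → base j P = 0

end Chain

/-- The Brill-Noether number `ρ(g, r, m) = g - (r + 1)(r + g - m)`. -/
def rho (g r m : ℤ) : ℤ := g - (r + 1) * (r + g - m)

/-- The expected dimension `μ = d - r (s + 1 - d + r)` of the space of `d`-secant
`(d - r - 1)`-planes to a fixed linear series of dimension `s`. -/
def mu (d r s : ℤ) : ℤ := d - r * (s + 1 - d + r)

end SecantChain

end

/-! The proof plays the total movement of the included series along the chain off against the
movement forced by its base points.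

From a curve only one analytic fact is needed, `degree_nonneg_of_mem_sections` with its sharp form
`val_eq_neg_of_degree_eq_zero`: a nonzero section of `𝒪(B)` forces `deg B ≥ 0`, and if `deg B = 0`
its divisor is exactly `-B`. Intersecting the two vanishing filtrations at `p` and `q` then gives
`a_i + b_{r-i} + deg D' ≤ m`, where `D'` is the base divisor away from `p` and `q`. Equality gives a
linear equivalence `a_i p + b_{r-i} q + D' ~ A`; since `p - q` is nontorsion, this happens for at
most one `i`.

Since `ρ = 0` means `m = s + us`, the word forces all vanishing orders of the ambient series:
propagating bounds from the left and right ends of the chain yields the same numbers `cyclicOrder`.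
The orders of the included series occur among them, so on `E_j` they are recorded by indices
`σ_j(i)` at `p_j` and `τ_j(i)` at `q_j`, and compatibility at the nodes says `τ_j(i) ≤ σ_{j+1}(i)`.

If `e_j` is the degree of the base divisor on `E_j` away from the marked points, then `∑_i (τ_j(i) -
σ_j(i))` is at least `r₂ e_j`, and at least `r₂ e_j + 1` when `e_j ≥ 2` (`le_sum_shift`). Summed
over the chain, the shifts telescope to at most `(r₂+1)(s - r₂ - x - y)`, with `x` and `y` the base
multiplicities at the two free ends. The condition `μ = 0` gives `(r₂+1)(s - r₂) = r₂ d`, so the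
budget has no slack: no `e_j` exceeds `1` and `x = y = 0`. -/

noncomputable section

namespace SecantChain

/-! ### Places as integer-valued valuations -/

section Places

variable {K F : Type*} [Field K] [Field F] [Algebra K F]

namespace Place

/-- The order of a nonzero rational function at a place, as an integer (`0` for `f = 0`). -/
def val (P : Place K F) (f : F) : ℤ := (P.ord f).untopD 0

theorem ord_eq_val (P : Place K F) {f : F} (hf : f ≠ 0) : P.ord f = (P.val f : WithTop ℤ) := by
  have h : P.ord f ≠ ⊤ := (AddValuation.ne_top_iff P.ord).2 hf
  obtain ⟨n, hn⟩ := WithTop.ne_top_iff_exists.1 h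
  simp [val, ← hn]

theorem le_ord_iff (P : Place K F) {f : F} (hf : f ≠ 0) {n : ℤ} :
    (n : WithTop ℤ) ≤ P.ord f ↔ n ≤ P.val f := by
  rw [P.ord_eq_val hf, WithTop.coe_le_coe]

theorem ord_eq_iff (P : Place K F) {f : F} (hf : f ≠ 0) {n : ℤ} :
    P.ord f = (n : WithTop ℤ) ↔ P.val f = n := by
  rw [P.ord_eq_val hf, WithTop.coe_inj]

theorem val_mul (P : Place K F) {f h : F} (hf : f ≠ 0) (hh : h ≠ 0) :
    P.val (f * h) = P.val f + P.val h := by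
  have := P.ord.map_mul f h
  rw [P.ord_eq_val hf, P.ord_eq_val hh, P.ord_eq_val (mul_ne_zero hf hh)] at this
  exact_mod_cast this

theorem val_algebraMap (P : Place K F) (c : K) : P.val (algebraMap K F c) = 0 := by
  rcases eq_or_ne c 0 with rfl | hc
  · simp [val]
  · simp [val, P.trivial_on_constants c hc]

theorem val_one (P : Place K F) : P.val 1 = 0 := by
  simpa using P.val_algebraMap 1

theorem val_zero (P : Place K F) : P.val 0 = 0 := by
  simpa using P.val_algebraMap 0

theorem val_inv (P : Place K F) (f : F) : P.val f⁻¹ = -P.val f := by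
  rcases eq_or_ne f 0 with rfl | hf
  · simp [P.val_zero]
  have := P.val_mul hf (inv_ne_zero hf)
  rw [mul_inv_cancel₀ hf, P.val_one] at this
  omega

theorem val_pow (P : Place K F) {f : F} (hf : f ≠ 0) (n : ℕ) : P.val (f ^ n) = n * P.val f := by
  induction n with
  | zero => simp [P.val_one]
  | succ n ih => rw [pow_succ, P.val_mul (pow_ne_zero _ hf) hf, ih]; push_cast; ring

theorem min_le_val_add (P : Place K F) {f h : F} (hf : f ≠ 0) (hh : h ≠ 0) (hfh : f + h ≠ 0) :
    min (P.val f) (P.val h) ≤ P.val (f + h) := by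
  have := P.ord.map_add f h
  rw [P.ord_eq_val hf, P.ord_eq_val hh, P.ord_eq_val hfh] at this
  exact_mod_cast this

theorem exists_val_eq (P : Place K F) (n : ℤ) : ∃ f : F, f ≠ 0 ∧ P.val f = n := by
  obtain ⟨f, hf⟩ := P.normalized n
  have h0 : f ≠ 0 := by
    rintro rfl
    simp at hf
  exact ⟨f, h0, (P.ord_eq_iff h0).1 hf⟩

theorem ext_ord {P Q : Place K F} (h : ∀ f, P.ord f = Q.ord f) : P = Q := by
  cases P; cases Q
  congr
  exact AddValuation.ext h

theorem ext_val {P Q : Place K F} (h : ∀ f, f ≠ 0 → P.val f = Q.val f) : P = Q := by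
  refine ext_ord fun f => ?_
  rcases eq_or_ne f 0 with rfl | hf
  · simp
  · rw [P.ord_eq_val hf, Q.ord_eq_val hf, h f hf]

open WithZero in
/-- The place attached to a surjective `ℤᵐ⁰`-valued valuation that is trivial on constants. -/
def ofValuation (v : Valuation F (WithZero (Multiplicative ℤ))) (hv : Function.Surjective v)
    (hK : ∀ c : K, c ≠ 0 → v (algebraMap K F c) = 1) : Place K F where
  ord := AddValuation.of
    (fun f => open Classical in if f = 0 then ⊤ else ((-(log (v f)) : ℤ) : WithTop ℤ))
    (by simp) (by simp)
    (fun f h => by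
      rcases eq_or_ne f 0 with rfl | hf
      · rw [zero_add]; exact min_le_right _ _
      rcases eq_or_ne h 0 with rfl | hh
      · rw [add_zero]; exact min_le_left _ _
      by_cases hfh : f + h = 0
      · simp [hfh]
      have hvf : v f ≠ 0 := (Valuation.ne_zero_iff v).2 hf
      have hvh : v h ≠ 0 := (Valuation.ne_zero_iff v).2 hh
      have hvfh : v (f + h) ≠ 0 := (Valuation.ne_zero_iff v).2 hfh
      simp only [hf, hh, hfh, if_false, ← WithTop.coe_min, WithTop.coe_le_coe]
      rcases v.map_add' f h with h1 | h1
      · have := (log_le_log hvfh hvf).2 h1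
        exact (min_le_left _ _).trans (neg_le_neg this)
      · have := (log_le_log hvfh hvh).2 h1
        exact (min_le_right _ _).trans (neg_le_neg this))
    (fun f h => by
      rcases eq_or_ne f 0 with rfl | hf
      · simp
      rcases eq_or_ne h 0 with rfl | hh
      · simp
      have hvf : v f ≠ 0 := (Valuation.ne_zero_iff v).2 hf
      have hvh : v h ≠ 0 := (Valuation.ne_zero_iff v).2 hh
      simp only [hf, hh, mul_eq_zero, or_self, if_false, map_mul, log_mul hvf hvh]
      rw [← WithTop.coe_add]
      congr 1
      ring)
  normalized := fun n => by
    obtain ⟨f, hf⟩ := hv (exp (-n))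
    have h0 : f ≠ 0 := by
      rintro rfl
      simp at hf
      exact exp_ne_zero hf.symm
    exact ⟨f, by simp [h0, hf]⟩
  trivial_on_constants := fun c hc => by simp [hc, hK c hc]

theorem ofValuation_le_one {v : Valuation F (WithZero (Multiplicative ℤ))}
    {hv : Function.Surjective v} {hK : ∀ c : K, c ≠ 0 → v (algebraMap K F c) = 1} {f : F}
    (hf : 0 ≤ (ofValuation v hv hK).ord f) : v f ≤ 1 := by
  rcases eq_or_ne f 0 with rfl | h0
  · simp
  have hvf : v f ≠ 0 := (Valuation.ne_zero_iff v).2 h0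
  simp only [ofValuation, AddValuation.of_apply, h0, if_false] at hf
  have h1 : (0 : ℤ) ≤ -(WithZero.log (v f)) := by exact_mod_cast hf
  rw [← WithZero.log_le_log hvf one_ne_zero, WithZero.log_one]
  omega

end Place

end Places

/-- `F` is an algebraic function field in one variable over `K`. -/
structure IsFunctionField (K F : Type*) [Field K] [Field F] [Algebra K F] : Prop where
  essFiniteType : Algebra.EssFiniteType K F
  trdeg_eq_one : Algebra.trdeg K F = 1

/-! ### Everywhere regular functions are constant -/

section Constants

variable {K F : Type*} [Field K] [Field F] [Algebra K F]

open Polynomial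

theorem isPrincipalIdealRing_adjoin_singleton (t : F) :
    IsPrincipalIdealRing (Algebra.adjoin K {t}) := by
  have h : Function.Surjective
      (aeval (R := K) (⟨t, Algebra.subset_adjoin rfl⟩ : Algebra.adjoin K {t})) := by
    rintro ⟨a, ha⟩
    rw [Algebra.adjoin_singleton_eq_range_aeval] at ha
    obtain ⟨p, rfl⟩ := ha
    exact ⟨p, Subtype.ext (by rw [← Subalgebra.coe_val, ← aeval_algHom_apply]; rfl)⟩
  exact IsPrincipalIdealRing.of_surjective _ h

open scoped IntermediateField.algebraAdjoinAdjoin in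
-- The integral closure of `K[t]` in `F` is a Dedekind domain with fraction field `F`. Each of its
-- height-one primes gives a place, and an element regular at all these primes lies in the ring.
theorem isIntegral_of_forall_ord_nonneg {t : F}
    [FiniteDimensional (IntermediateField.adjoin K {t}) F]
    [Algebra.IsSeparable (IntermediateField.adjoin K {t}) F] {f : F}
    (hf : ∀ P : Place K F, 0 ≤ P.ord f) : IsIntegral (Algebra.adjoin K {t}) f := by
  have hpid := isPrincipalIdealRing_adjoin_singleton (K := K) t
  let A := Algebra.adjoin K {t}
  let L := IntermediateField.adjoin K {t}
  let C := integralClosure A F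
  have hC : IsDedekindDomain C := integralClosure.isDedekindDomain A L F
  have hfr : IsFractionRing C F :=
    integralClosure.isFractionRing_of_finite_extension L F
  have hmem : f ∈ (algebraMap C F).range := by
    refine IsDedekindDomain.HeightOneSpectrum.mem_integers_of_valuation_le_one F f fun v => ?_
    refine Place.ofValuation_le_one (K := K) (hv := v.valuation_surjective F) (hK := fun c hc => ?_)
      (hf _)
    have hle : ∀ c : K, v.valuation F (algebraMap K F c) ≤ 1 := fun c => by
      rw [IsScalarTower.algebraMap_apply K A F, IsScalarTower.algebraMap_apply A C F]
      exact v.valuation_le_one _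
    refine le_antisymm (hle c) ?_
    have := hle c⁻¹
    rw [map_inv₀, map_inv₀] at this
    exact (inv_le_one₀ (zero_lt_iff.2 ((Valuation.ne_zero_iff _).2 (by simpa using hc)))).1 this
  obtain ⟨c, rfl⟩ := hmem
  exact c.2

/-- If `p(t) = q(1/t)`, multiplying by `t ^ deg q` turns the right side into the reversed polynomial
of `q`, of degree at most `deg q`; hence `deg p = 0`. -/
theorem mem_range_algebraMap_of_mem_adjoin_of_mem_adjoin_inv {t : F} (ht : Transcendental K t)
    {a : F} (ha : a ∈ Algebra.adjoin K {t}) (ha' : a ∈ Algebra.adjoin K {t⁻¹}) :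
    a ∈ (algebraMap K F).range := by
  rw [Algebra.adjoin_singleton_eq_range_aeval] at ha ha'
  obtain ⟨p, rfl⟩ := ha
  obtain ⟨q, hq⟩ := ha'
  have ht0 : t ≠ 0 := by
    rintro rfl
    exact ht isAlgebraic_zero
  let _ : Invertible (t⁻¹) := invertibleOfNonzero (inv_ne_zero ht0)
  have h1 := eval₂_reverse_mul_pow (algebraMap K F) t⁻¹ q
  have h2 : (⅟ (t⁻¹)) = t := by simp
  rw [h2] at h1
  have h3 : aeval t (reverse q) = aeval t (p * X ^ q.natDegree) := by
    change aeval t⁻¹ q = aeval t p at hq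
    rw [map_mul, map_pow, aeval_X, ← hq, aeval_def, aeval_def, ← h1, mul_assoc, ← mul_pow,
      inv_mul_cancel₀ ht0, one_pow,
      mul_one]
  have h4 := transcendental_iff_injective.1 ht h3
  have h5 : p.natDegree = 0 := by
    rcases eq_or_ne p 0 with rfl | hp
    · simp
    have := congrArg natDegree h4
    rw [natDegree_mul hp (pow_ne_zero _ X_ne_zero), natDegree_X_pow] at this
    have := reverse_natDegree_le q
    omega
  rw [eq_C_of_natDegree_eq_zero h5]
  simp

theorem IsFunctionField.isAlgebraic_adjoin (h : IsFunctionField K F) {f : F}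
    (hf : Transcendental K f) : Algebra.IsAlgebraic (IntermediateField.adjoin K {f}) F := by
  have h1 : AlgebraicIndependent K (fun _ : Unit => f) :=
    algebraicIndependent_unique_type_iff.2 hf
  have h2 := h1.isTranscendenceBasis_of_lift_trdeg_le_of_finite (by simp [h.trdeg_eq_one])
  have h3 := h2.isAlgebraic_field
  rwa [Set.range_const] at h3

theorem IsFunctionField.finiteDimensional_adjoin (h : IsFunctionField K F) {f : F}
    (hf : Transcendental K f) : FiniteDimensional (IntermediateField.adjoin K {f}) F := by
  have := h.isAlgebraic_adjoin hf
  have := h.essFiniteType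
  have : Algebra.EssFiniteType (IntermediateField.adjoin K {f}) F :=
    Algebra.EssFiniteType.of_comp K _ _
  exact Algebra.finite_of_essFiniteType_of_isAlgebraic

theorem IsFunctionField.exists_separating [IsAlgClosed K] (h : IsFunctionField K F) :
    ∃ t : F, Transcendental K t ∧ Algebra.IsSeparable (IntermediateField.adjoin K {t}) F := by
  have := h.essFiniteType
  obtain ⟨s, hs, hsep⟩ := exists_isTranscendenceBasis_and_isSeparable_of_perfectField K F
  have h1 := hs.lift_cardinalMk_eq_trdeg
  rw [h.trdeg_eq_one] at h1
  have h2 : s.card = 1 := by simpa using h1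
  obtain ⟨t, rfl⟩ := Finset.card_eq_one.1 h2
  rw [Finset.coe_singleton] at hsep
  refine ⟨t, ?_, hsep⟩
  exact hs.1.transcendental ⟨t, by simp⟩

theorem transcendental_of_not_mem_range [IsAlgClosed K] {f : F}
    (hf : f ∉ (algebraMap K F).range) : Transcendental K f := by
  intro h
  exact hf (minpoly.mem_range_of_degree_eq_one K f
    (IsAlgClosed.degree_eq_one_of_irreducible K (minpoly.irreducible h.isIntegral)))

open scoped IntermediateField.algebraAdjoinAdjoin in
theorem coeff_minpoly_mem_adjoin {t f : F} (hf : IsIntegral (Algebra.adjoin K {t}) f) (i : ℕ) :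
    ((minpoly (IntermediateField.adjoin K {t}) f).coeff i : F) ∈ Algebra.adjoin K {t} := by
  have := isPrincipalIdealRing_adjoin_singleton (K := K) t
  rw [minpoly.isIntegrallyClosed_eq_field_fractions' (IntermediateField.adjoin K {t}) hf,
    coeff_map]
  exact ((minpoly (Algebra.adjoin K {t}) f).coeff i).2

/-- Such an `f` is integral over both `K[t]` and `K[1/t]`, so its minimal polynomial over `K(t) =
K(1/t)` has coefficients in `K[t] ∩ K[1/t] = K`. Thus `f` is algebraic over the algebraically closed
field `K`. -/
theorem IsFunctionField.mem_range_of_forall_ord_nonneg [IsAlgClosed K] (h : IsFunctionField K F)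
    {f : F} (hf : ∀ P : Place K F, 0 ≤ P.ord f) : f ∈ (algebraMap K F).range := by
  obtain ⟨t, ht, hsep⟩ := h.exists_separating
  have hfd := h.finiteDimensional_adjoin ht
  have h1 := coeff_minpoly_mem_adjoin (isIntegral_of_forall_ord_nonneg (t := t) hf)
  have h2 : ∀ i, ((minpoly (IntermediateField.adjoin K {t}) f).coeff i : F) ∈
      Algebra.adjoin K {t⁻¹} := by
    have heq : IntermediateField.adjoin K {t⁻¹} = IntermediateField.adjoin K {t} := by
      apply le_antisymm <;> rw [IntermediateField.adjoin_simple_le_iff]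
      · exact inv_mem (IntermediateField.mem_adjoin_simple_self K t)
      · simpa using inv_mem (IntermediateField.mem_adjoin_simple_self K t⁻¹)
    rw [← heq] at hfd hsep ⊢
    exact coeff_minpoly_mem_adjoin (isIntegral_of_forall_ord_nonneg (t := t⁻¹) hf)
  by_contra hcon
  refine transcendental_of_not_mem_range hcon ?_
  have hint : IsIntegral (IntermediateField.adjoin K {t}) f := Algebra.IsIntegral.isIntegral f
  set Q : F[X] := (minpoly (IntermediateField.adjoin K {t}) f).map (algebraMap _ F) with hQ
  have hmonic : Q.Monic := (minpoly.monic hint).map _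
  have hlift : Q ∈ Polynomial.lifts (algebraMap K F) := by
    rw [Polynomial.lifts_iff_coeff_lifts]
    intro i
    rw [hQ, coeff_map]
    exact mem_range_algebraMap_of_mem_adjoin_of_mem_adjoin_inv ht (h1 i) (h2 i)
  obtain ⟨q, hq, -, hqm⟩ := lifts_and_degree_eq_and_monic hlift hmonic
  refine ⟨q, hqm.ne_zero, ?_⟩
  rw [aeval_def, ← eval_map, hq, hQ, eval_map, ← aeval_def, minpoly.aeval]

end Constants

/-! ### Elliptic function fields have transcendence degree one -/

section Elliptic

variable {K F : Type*} [Field K] [Field F] [Algebra K F]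

theorem IsFunctionField.of_isEllipticFunctionField (h : IsEllipticFunctionField K F) :
    IsFunctionField K F := by
  obtain ⟨W, -, ⟨e⟩⟩ := h
  have : IsScalarTower K W.toAffine.CoordinateRing W.toAffine.FunctionField := inferInstance
  have hfin : Module.Finite (Polynomial K) W.toAffine.CoordinateRing :=
    .of_basis (WeierstrassCurve.Affine.CoordinateRing.basis W.toAffine)
  have : Algebra.EssFiniteType K W.toAffine.CoordinateRing :=
    .comp K (Polynomial K) _
  have h1 : Algebra.EssFiniteType K W.toAffine.FunctionField :=
    have : Algebra.EssFiniteType W.toAffine.CoordinateRing W.toAffine.FunctionField :=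
      .of_isLocalization _ (nonZeroDivisors W.toAffine.CoordinateRing)
    .comp K W.toAffine.CoordinateRing _
  refine ⟨.of_surjective e.symm.toAlgHom e.symm.surjective, ?_⟩
  have h2 : Algebra.IsAlgebraic (Polynomial K) W.toAffine.CoordinateRing :=
    Algebra.IsIntegral.isAlgebraic
  have h3 : Algebra.trdeg K W.toAffine.FunctionField = 1 := by
    rw [← trdeg_add_eq K W.toAffine.CoordinateRing,
      ← trdeg_add_eq K (Polynomial K) (A := W.toAffine.CoordinateRing),
      Polynomial.trdeg_of_isDomain, trdeg_eq_zero_iff.2 h2, add_zero,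
      trdeg_eq_zero_iff.2
        (IsLocalization.isAlgebraic _ (nonZeroDivisors W.toAffine.CoordinateRing)), add_zero]
  simpa [h3] using e.lift_trdeg_eq

end Elliptic

/-! ### Weak approximation and the bound on zeros -/

section Approximation

variable {K F : Type*} [Field K] [Field F] [Algebra K F]

open Polynomial

namespace Place

theorem val_nonneg_iff (P : Place K F) (f : F) : 0 ≤ P.ord f ↔ 0 ≤ P.val f := by
  rcases eq_or_ne f 0 with rfl | hf
  · simp [P.val_zero]
  · exact_mod_cast P.le_ord_iff hf (n := 0)

theorem sum_ne_zero_of_unique_min (P : Place K F) {ι : Type*} {s : Finset ι} {f : ι → F}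
    {i : ι} (hi : i ∈ s) (hfi : f i ≠ 0) (h : ∀ j ∈ s, j ≠ i → P.ord (f i) < P.ord (f j)) :
    ∑ j ∈ s, f j ≠ 0 := by
  classical
  intro h0
  rw [← Finset.add_sum_erase s f hi] at h0
  have h1 : P.ord (f i) < P.ord (∑ j ∈ s.erase i, f j) := by
    refine P.ord.map_lt_sum ((AddValuation.ne_top_iff P.ord).2 hfi) fun j hj => ?_
    rw [Finset.mem_erase] at hj
    exact h j hj.2 hj.1
  rw [eq_neg_of_add_eq_zero_left h0, AddValuation.map_neg] at h1
  exact lt_irrefl _ h1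

/-- Comparing `f` with powers of a uniformizer of `P` shows that the valuation of `Q` is a constant
multiple of that of `P`. Normalization makes the factor `±1`, and the second hypothesis excludes
`-1`. -/
theorem eq_of_val_eq_zero_imp {P Q : Place K F}
    (h0 : ∀ f, f ≠ 0 → P.val f = 0 → Q.val f = 0) (h1 : ∀ f, f ≠ 0 → P.val f = 1 → 0 ≤ Q.val f) :
    P = Q := by
  obtain ⟨π, hπ, hπ1⟩ := P.exists_val_eq 1
  have hval : ∀ f, f ≠ 0 → Q.val f = P.val f * Q.val π := by
    have key : ∀ f, f ≠ 0 → 0 ≤ P.val f → Q.val f = P.val f * Q.val π := by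
      intro f hf hn
      obtain ⟨n, hn⟩ := Int.eq_ofNat_of_zero_le hn
      have h2 := h0 (f * (π ^ n)⁻¹) (mul_ne_zero hf (inv_ne_zero (pow_ne_zero _ hπ))) (by
        rw [P.val_mul hf (inv_ne_zero (pow_ne_zero _ hπ)), P.val_inv, P.val_pow hπ, hn, hπ1]
        ring)
      rw [Q.val_mul hf (inv_ne_zero (pow_ne_zero _ hπ)), Q.val_inv, Q.val_pow hπ] at h2
      rw [hn]
      linarith
    intro f hf
    rcases le_total 0 (P.val f) with hn | hn
    · exact key f hf hn
    · have := key f⁻¹ (inv_ne_zero hf) (by rw [P.val_inv]; omega)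
      rw [P.val_inv, Q.val_inv] at this
      linarith
  obtain ⟨ϖ, hϖ, hϖ1⟩ := Q.exists_val_eq 1
  have h2 := hval ϖ hϖ
  have h3 := h1 π hπ hπ1
  rw [hϖ1] at h2
  have h4 : Q.val π = 1 := by
    rcases Int.eq_one_or_neg_one_of_mul_eq_one' h2.symm with h | h
    · exact h.2
    · omega
  exact ext_val fun f hf => by rw [hval f hf, h4, mul_one]

/-- The absolute value `2 ^ (-ord)` attached to a place. -/
def absValue (P : Place K F) : AbsoluteValue F ℝ where
  toFun f := open Classical in if f = 0 then 0 else (2 : ℝ) ^ (-P.val f)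
  map_mul' f h := by
    by_cases hf : f = 0
    · simp [hf]
    by_cases hh : h = 0
    · simp [hh]
    simp only [hf, hh, mul_eq_zero, or_self, if_false]
    rw [P.val_mul hf hh, neg_add, zpow_add₀ two_ne_zero]
  nonneg' f := by
    split_ifs <;> positivity
  eq_zero' f := by
    by_cases hf : f = 0
    · simp [hf]
    · simp [hf, zpow_ne_zero]
  add_le' f h := by
    by_cases hf : f = 0
    · rw [hf, zero_add]; simp
    by_cases hh : h = 0
    · rw [hh, add_zero]; simp
    by_cases hfh : f + h = 0
    · simp only [hfh, if_true]
      positivity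
    simp only [hf, hh, hfh, if_false]
    have h2 : ∀ n : ℤ, (0 : ℝ) < 2 ^ (-n) := fun n => by positivity
    rcases min_le_iff.1 (P.min_le_val_add hf hh hfh) with h1 | h1
    · have := zpow_le_zpow_right₀ (one_le_two (α := ℝ)) (neg_le_neg h1)
      linarith [h2 (P.val h)]
    · have := zpow_le_zpow_right₀ (one_le_two (α := ℝ)) (neg_le_neg h1)
      linarith [h2 (P.val f)]

theorem absValue_apply (P : Place K F) {f : F} (hf : f ≠ 0) :
    P.absValue f = (2 : ℝ) ^ (-P.val f) := by
  simp [absValue, hf]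

theorem absValue_lt_one_iff (P : Place K F) {f : F} (hf : f ≠ 0) :
    P.absValue f < 1 ↔ 0 < P.val f := by
  rw [P.absValue_apply hf, zpow_lt_one_iff_right₀ one_lt_two]
  omega

theorem one_lt_absValue_iff (P : Place K F) {f : F} (hf : f ≠ 0) :
    1 < P.absValue f ↔ P.val f < 0 := by
  rw [P.absValue_apply hf, one_lt_zpow_iff_right₀ one_lt_two]
  omega

theorem absValue_isNontrivial (P : Place K F) : P.absValue.IsNontrivial := by
  obtain ⟨f, hf, h1⟩ := P.exists_val_eq 1
  exact ⟨f, hf, ((P.absValue_lt_one_iff hf).2 (by omega)).ne⟩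

theorem eq_of_absValue_isEquiv {P Q : Place K F} (h : P.absValue.IsEquiv Q.absValue) : P = Q := by
  refine eq_of_val_eq_zero_imp (fun f hf h0 => ?_) (fun f hf h1 => ?_)
  · have h1 := h.lt_one_iff (x := f)
    have h2 := h.one_lt_iff (x := f)
    rw [P.absValue_lt_one_iff hf, Q.absValue_lt_one_iff hf] at h1
    rw [P.one_lt_absValue_iff hf, Q.one_lt_absValue_iff hf] at h2
    omega
  · have h2 := h.lt_one_iff (x := f)
    rw [P.absValue_lt_one_iff hf, Q.absValue_lt_one_iff hf] at h2
    omega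

theorem exists_val_neg_pos (S : Finset (Place K F)) {P : Place K F} (hP : P ∈ S) :
    ∃ w : F, w ≠ 0 ∧ P.val w < 0 ∧ ∀ Q ∈ S, Q ≠ P → 0 < Q.val w := by
  obtain ⟨w, hw, hw'⟩ := AbsoluteValue.exists_one_lt_lt_one_pi_of_not_isEquiv
    (v := fun Q : S => Q.1.absValue) (fun Q => Q.1.absValue_isNontrivial)
    (fun Q R hQR h => hQR (Subtype.ext (eq_of_absValue_isEquiv h))) ⟨P, hP⟩
  have h0 : w ≠ 0 := by
    rintro rfl
    simp at hw
    linarith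
  refine ⟨w, h0, (P.one_lt_absValue_iff h0).1 hw, fun Q hQ hQP => ?_⟩
  exact (Q.absValue_lt_one_iff h0).1 (hw' ⟨Q, hQ⟩ fun h => hQP (congrArg Subtype.val h))

theorem val_add_of_lt (P : Place K F) {f h : F} (hf : f ≠ 0) (hh : h ≠ 0)
    (hlt : P.val f < P.val h) : f + h ≠ 0 ∧ P.val (f + h) = P.val f := by
  have h1 : P.ord f < P.ord h := by
    rw [P.ord_eq_val hf, P.ord_eq_val hh]
    exact_mod_cast hlt
  have h2 := P.ord.map_add_eq_of_lt_left h1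
  rw [P.ord_eq_val hf] at h2
  have h3 : f + h ≠ 0 := by
    intro h3
    rw [h3, AddValuation.map_zero] at h2
    exact WithTop.top_ne_coe h2
  exact ⟨h3, (P.ord_eq_iff h3).1 h2⟩

theorem exists_val_eq_zero_le (S : Finset (Place K F)) {P : Place K F} (hP : P ∈ S) (N : ℕ) :
    ∃ u : F, u ≠ 0 ∧ P.val u = 0 ∧ ∀ Q ∈ S, Q ≠ P → (N : ℤ) ≤ Q.val u := by
  obtain ⟨w, hw, hwP, hwQ⟩ := exists_val_neg_pos S hP
  have hn : w ^ (N + 1) ≠ 0 := pow_ne_zero _ hw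
  have hP1 := P.val_add_of_lt hn one_ne_zero (by
    rw [P.val_pow hw, P.val_one]
    push_cast
    nlinarith)
  have hsum := hP1.1
  -- With `W = w ^ (N + 1)`, the function `W / (W + 1)` is a unit where `w` has a pole and vanishes
  -- like `W` where `w` has a zero.
  refine ⟨w ^ (N + 1) * (w ^ (N + 1) + 1)⁻¹, mul_ne_zero hn (inv_ne_zero hsum), ?_,
    fun Q hQ hQP => ?_⟩
  · rw [P.val_mul hn (inv_ne_zero hsum), P.val_inv, hP1.2]
    ring
  · have hpos := hwQ Q hQ hQP
    have hQ1 := Q.val_add_of_lt one_ne_zero hn (by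
      rw [Q.val_pow hw, Q.val_one]
      positivity)
    rw [Q.val_mul hn (inv_ne_zero hsum), Q.val_inv, add_comm (w ^ (N + 1)) 1, hQ1.2, Q.val_one,
      Q.val_pow hw]
    push_cast
    nlinarith

/-- Weak approximation for orders of vanishing. -/
theorem exists_val_eq_and_le (S : Finset (Place K F)) {P : Place K F} (hP : P ∈ S) (n : ℤ)
    (b : Place K F → ℤ) :
    ∃ z : F, z ≠ 0 ∧ P.val z = n ∧ ∀ Q ∈ S, Q ≠ P → b Q ≤ Q.val z := by
  obtain ⟨y, hy, hyn⟩ := P.exists_val_eq n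
  obtain ⟨u, hu, hu0, huQ⟩ := exists_val_eq_zero_le S hP (∑ Q ∈ S, (b Q - Q.val y).toNat)
  refine ⟨u * y, mul_ne_zero hu hy, by rw [P.val_mul hu hy, hu0, hyn, zero_add],
    fun Q hQ hQP => ?_⟩
  have h1 := huQ Q hQ hQP
  have h2 : (b Q - Q.val y).toNat ≤ ∑ Q ∈ S, (b Q - Q.val y).toNat :=
    Finset.single_le_sum (f := fun Q => (b Q - Q.val y).toNat) (fun _ _ => Nat.zero_le _) hQ
  rw [Q.val_mul hu hy]
  omega

theorem ord_aeval_nonneg (P : Place K F) {t : F} (ht : 0 ≤ P.ord t) (p : K[X]) :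
    0 ≤ P.ord (aeval t p) := by
  rw [aeval_eq_sum_range]
  refine P.ord.map_le_sum fun i _ => ?_
  rw [Algebra.smul_def, AddValuation.map_mul, AddValuation.map_pow]
  have h1 : 0 ≤ P.ord (algebraMap K F (p.coeff i)) := by
    rw [P.val_nonneg_iff, P.val_algebraMap]
  exact add_nonneg h1 (nsmul_nonneg ht i)

theorem val_aeval (P : Place K F) {t : F} (ht : 0 < P.val t) {p : K[X]} (hp : p ≠ 0) :
    aeval t p ≠ 0 ∧ P.val (aeval t p) = p.natTrailingDegree * P.val t := by
  have ht0 : t ≠ 0 := by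
    rintro rfl
    simp [P.val_zero] at ht
  obtain ⟨q, hq⟩ : X ^ p.natTrailingDegree ∣ p := by
    rw [X_pow_dvd_iff]
    exact fun d hd => coeff_eq_zero_of_lt_natTrailingDegree hd
  have hq0 : q.coeff 0 ≠ 0 := by
    have : p.coeff p.natTrailingDegree ≠ 0 := trailingCoeff_nonzero_iff_nonzero.2 hp
    generalize p.natTrailingDegree = k at hq this
    rw [hq, coeff_X_pow_mul'] at this
    simpa using this
  have hqt : aeval t q = algebraMap K F (q.coeff 0) + t * aeval t q.divX := by
    conv_lhs => rw [← divX_mul_X_add q]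
    simp only [map_add, map_mul, aeval_X, aeval_C]
    ring
  have hc : algebraMap K F (q.coeff 0) ≠ 0 := by simpa using hq0
  have hval : aeval t q ≠ 0 ∧ P.val (aeval t q) = 0 := by
    by_cases hd : aeval t q.divX = 0
    · rw [hqt, hd, mul_zero, add_zero]
      exact ⟨hc, P.val_algebraMap _⟩
    · have h1 := (P.val_nonneg_iff _).1
        (P.ord_aeval_nonneg ((P.val_nonneg_iff t).2 ht.le) q.divX)
      have := P.val_add_of_lt hc (mul_ne_zero ht0 hd) (by
        rw [P.val_algebraMap, P.val_mul ht0 hd]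
        omega)
      rw [hqt]
      exact ⟨this.1, this.2.trans (P.val_algebraMap _)⟩
  have hpt : aeval t p = t ^ p.natTrailingDegree * aeval t q := by
    conv_lhs => rw [hq]
    simp
  rw [hpt]
  refine ⟨mul_ne_zero (pow_ne_zero _ ht0) hval.1, ?_⟩
  rw [P.val_mul (pow_ne_zero _ ht0) hval.1, hval.2, P.val_pow ht0, add_zero]

end Place

theorem linearIndependent_adjoin_of_aeval {t : F} {ι : Type*} [Fintype ι] {z : ι → F}
    (h : ∀ φ : ι → K[X], ∑ i, aeval t (φ i) * z i = 0 → ∀ i, aeval t (φ i) = 0) :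
    LinearIndependent (IntermediateField.adjoin K {t}) z := by
  open scoped IntermediateField.algebraAdjoinAdjoin in
  rw [← LinearIndependent.iff_fractionRing (Algebra.adjoin K {t})
    (IntermediateField.adjoin K {t}), Fintype.linearIndependent_iff]
  intro c hc i
  have hφ : ∀ i, ∃ φ : K[X], aeval t φ = (c i : F) := fun i => by
    exact (Algebra.adjoin_singleton_eq_range_aeval K t).le (c i).2
  choose φ hφ using hφ
  have := h φ (by simpa [hφ, Algebra.smul_def] using hc) i
  rw [hφ] at this
  exact Subtype.ext this

/-- The number of zeros of `t`, counted with multiplicity, is at most the degree of `F` over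
`K(t)`. -/
theorem sum_val_le_finrank {t : F} [FiniteDimensional (IntermediateField.adjoin K {t}) F]
    (S : Finset (Place K F)) (hS : ∀ P ∈ S, 0 < P.val t) :
    ∑ P ∈ S, P.val t ≤ Module.finrank (IntermediateField.adjoin K {t}) F := by
  classical
  -- For each zero `P` of `t` and each `0 ≤ l < ord_P t`, take a function of order `l` at `P` and of
  -- order at least `ord_Q t` at every other `Q`. There are as many of them as zeros with
  -- multiplicity, and they will be independent over `K(t)`.
  have hz : ∀ x : (Σ P : S, Fin (P.1.val t).toNat), ∃ z : F, z ≠ 0 ∧ x.1.1.val z = (x.2 : ℕ) ∧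
      ∀ Q ∈ S, Q ≠ x.1.1 → Q.val t ≤ Q.val z := fun x =>
    Place.exists_val_eq_and_le S x.1.2 _ fun Q => Q.val t
  choose z hz0 hz1 hz2 using hz
  have hind : LinearIndependent (IntermediateField.adjoin K {t}) z := by
    refine linearIndependent_adjoin_of_aeval fun φ hφ => ?_
    by_contra! hne
    obtain ⟨i₀, hi₀⟩ := hne
    let T : Finset (Σ P : S, Fin (P.1.val t).toNat) := Finset.univ.filter fun i => φ i ≠ 0
    have hT : T.Nonempty := ⟨i₀, by
      simp only [T, Finset.mem_filter, Finset.mem_univ, true_and]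
      rintro h
      simp [h] at hi₀⟩
    obtain ⟨i₁, hi₁, hmin₁⟩ := T.exists_min_image (fun i => (φ i).natTrailingDegree) hT
    -- Among the terms whose coefficient has the least `t`-adic order `k`, fix one point `P` and
    -- then the least `l`. At `P` this term has order `k ord_P t + l < (k + 1) ord_P t`, strictly
    -- below every other term, so the sum cannot vanish.
    let T' := T.filter fun i => i.1 = i₁.1 ∧ (φ i).natTrailingDegree = (φ i₁).natTrailingDegree
    obtain ⟨⟨P, j⟩, hi₂, hmin₂⟩ := T'.exists_min_image (fun i => (i.2 : ℕ))
      ⟨i₁, by simp [T', hi₁]⟩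
    simp only [T', T, Finset.mem_filter, Finset.mem_univ, true_and] at hi₂ hmin₁ hmin₂ hi₁
    obtain ⟨hφ₂, hP, hk⟩ := hi₂
    have hpos := hS P P.2
    have hval : ∀ i, φ i ≠ 0 → aeval t (φ i) * z i ≠ 0 ∧ P.1.val (aeval t (φ i) * z i) =
        (φ i).natTrailingDegree * P.1.val t + P.1.val (z i) := fun i hi => by
      have := P.1.val_aeval hpos hi
      refine ⟨mul_ne_zero this.1 (hz0 i), ?_⟩
      rw [P.1.val_mul this.1 (hz0 i), this.2]
    refine P.1.sum_ne_zero_of_unique_min (Finset.mem_univ ⟨P, j⟩) (hval _ hφ₂).1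
      (fun i _ hi => ?_) hφ
    by_cases hφi : φ i = 0
    · rw [hφi, map_zero, zero_mul, AddValuation.map_zero, P.1.ord_eq_val (hval _ hφ₂).1]
      exact WithTop.coe_lt_top _
    rw [P.1.ord_eq_val (hval _ hφ₂).1, P.1.ord_eq_val (hval _ hφi).1, WithTop.coe_lt_coe,
      (hval _ hφ₂).2, (hval _ hφi).2]
    have h1 : P.1.val (z ⟨P, j⟩) = (j : ℕ) := hz1 ⟨P, j⟩
    have hjlt : ((j : ℕ) : ℤ) < P.1.val t := by have := j.2; omega
    have hk1 : (φ ⟨P, j⟩).natTrailingDegree ≤ (φ i).natTrailingDegree := hk ▸ hmin₁ i hφi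
    rw [h1]
    obtain ⟨Q, l⟩ := i
    by_cases hQ : Q = P
    · subst hQ
      have h2 : Q.1.val (z ⟨Q, l⟩) = (l : ℕ) := hz1 ⟨Q, l⟩
      rw [h2]
      rcases hk1.eq_or_lt with heq | hlt
      · have h3 := hmin₂ ⟨Q, l⟩ ⟨hφi, hP, heq ▸ hk⟩
        have h4 : (j : ℕ) ≠ l := fun h => hi (by rw [Fin.ext h])
        simp only at h3
        rw [heq]
        omega
      · have : ((φ ⟨Q, j⟩).natTrailingDegree : ℤ) + 1 ≤ (φ ⟨Q, l⟩).natTrailingDegree := by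
          exact_mod_cast hlt
        nlinarith
    · have h2 := hz2 ⟨Q, l⟩ P.1 P.2 fun h => hQ (Subtype.ext h.symm)
      have : ((φ ⟨P, j⟩).natTrailingDegree : ℤ) ≤ (φ ⟨Q, l⟩).natTrailingDegree := by
        exact_mod_cast hk1
      nlinarith
  have hcard := hind.fintype_card_le_finrank
  rw [Fintype.card_sigma] at hcard
  simp only [Fintype.card_fin] at hcard
  rw [← Finset.sum_coe_sort]
  calc ∑ P : S, P.1.val t = ((∑ P : S, (P.1.val t).toNat : ℕ) : ℤ) := by
        push_cast
        exact Finset.sum_congr rfl fun P _ => by have := hS P P.2; omega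
    _ ≤ _ := by exact_mod_cast hcard

end Approximation

/-! ### Degrees of divisors with sections -/

section Degree

variable {K F : Type*} [Field K] [Field F] [Algebra K F]

open Polynomial

namespace Place

theorem ord_nonneg_of_isIntegral (P : Place K F) {R : Type*} [CommRing R] [Algebra R F]
    (hR : ∀ r : R, 0 ≤ P.ord (algebraMap R F r)) {h : F} (hh : IsIntegral R h) :
    0 ≤ P.ord h := by
  obtain ⟨p, hp, hp0⟩ := hh
  by_contra! hneg
  have h0 : h ≠ 0 := by
    rintro rfl
    simp at hneg
  rw [eval₂_eq_sum_range] at hp0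
  refine P.sum_ne_zero_of_unique_min (i := p.natDegree) (by simp) ?_ (fun j hj hjn => ?_) hp0
  · rw [hp.coeff_natDegree, map_one, one_mul]
    exact pow_ne_zero _ h0
  · rw [hp.coeff_natDegree, map_one, one_mul, AddValuation.map_mul]
    have hlt : j < p.natDegree := by
      simp only [Finset.mem_range] at hj
      omega
    have h1 : P.ord (h ^ p.natDegree) < P.ord (h ^ j) := by
      rw [P.ord_eq_val (pow_ne_zero _ h0), P.ord_eq_val (pow_ne_zero _ h0), P.val_pow h0,
        P.val_pow h0, WithTop.coe_lt_coe]
      have : P.val h < 0 := by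
        rw [P.ord_eq_val h0] at hneg
        exact_mod_cast hneg
      have h2 : (j : ℤ) < p.natDegree := by exact_mod_cast hlt
      nlinarith
    exact h1.trans_le (le_add_of_nonneg_left (hR _))

/-- Otherwise all `f - c` are units at `P`, hence so are all nonzero polynomials in `f`, which split
into linear factors. Then `K(f)` lies in the valuation ring, and so does `F`, which is integral over
`K(f)`; but some function has a pole at `P`. -/
theorem exists_residue [IsAlgClosed K] (hF : IsFunctionField K F) (P : Place K F) {f : F}
    (hf : 0 ≤ P.ord f) : ∃ c : K, 0 < P.ord (f - algebraMap K F c) := by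
  by_cases hK : f ∈ (algebraMap K F).range
  · obtain ⟨c, rfl⟩ := hK
    exact ⟨c, by simp⟩
  by_contra! hcon
  have htr := transcendental_of_not_mem_range hK
  have hsub : ∀ c, P.ord (f - algebraMap K F c) = 0 := fun c =>
    le_antisymm (hcon c) (P.ord.map_le_sub hf (by rw [P.val_nonneg_iff, P.val_algebraMap]))
  have hpoly : ∀ p : K[X], p ≠ 0 → P.ord (aeval f p) = 0 := by
    intro p hp
    have h1 := (IsAlgClosed.splits p).eq_prod_roots
    rw [h1, map_mul, aeval_C, AddValuation.map_mul,
      P.trivial_on_constants _ (leadingCoeff_ne_zero.2 hp), zero_add]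
    induction p.roots using Multiset.induction_on with
    | empty => simp
    | cons a s ih =>
      rw [Multiset.map_cons, Multiset.prod_cons, map_mul, AddValuation.map_mul, ih, add_zero,
        map_sub, aeval_X, aeval_C, hsub]
  have hfield : ∀ r : IntermediateField.adjoin K {f},
      0 ≤ P.ord (algebraMap (IntermediateField.adjoin K {f}) F r) := by
    rintro ⟨r, hr⟩
    rw [IntermediateField.mem_adjoin_simple_iff] at hr
    obtain ⟨p, q, rfl⟩ := hr
    change 0 ≤ P.ord (aeval f p / aeval f q)
    rcases eq_or_ne p 0 with rfl | hp
    · simp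
    rcases eq_or_ne q 0 with rfl | hq
    · simp
    have hp' : aeval f p ≠ 0 := fun h => hp (transcendental_iff.1 htr p h)
    have hq' : aeval f q ≠ 0 := fun h => hq (transcendental_iff.1 htr q h)
    have h1 := hpoly p hp
    have h2 := hpoly q hq
    rw [P.ord_eq_val hp'] at h1
    rw [P.ord_eq_val hq'] at h2
    have h1' : P.val (aeval f p) = 0 := by exact_mod_cast h1
    have h2' : P.val (aeval f q) = 0 := by exact_mod_cast h2
    rw [P.val_nonneg_iff, div_eq_mul_inv, P.val_mul hp' (inv_ne_zero hq'), P.val_inv, h1', h2']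
    simp
  have := hF.isAlgebraic_adjoin htr
  obtain ⟨g, -, hg⟩ := P.exists_val_eq (-1)
  have := (P.val_nonneg_iff g).1 (P.ord_nonneg_of_isIntegral hfield
    (Algebra.IsAlgebraic.isAlgebraic (R := IntermediateField.adjoin K {f}) g).isIntegral)
  omega

/-- The functions in `V` of order at least `n` at `P`. -/
def filtration (P : Place K F) (V : Submodule K F) (n : ℤ) : Submodule K F where
  carrier := {f | f ∈ V ∧ (n : WithTop ℤ) ≤ P.ord f}
  zero_mem' := ⟨V.zero_mem, by simp⟩
  add_mem' := fun hf hh => ⟨V.add_mem hf.1 hh.1, P.ord.map_le_add hf.2 hh.2⟩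
  smul_mem' := fun c f hf => ⟨V.smul_mem c hf.1, by
    rw [Algebra.smul_def, AddValuation.map_mul]
    exact le_add_of_nonneg_of_le (by rw [P.val_nonneg_iff, P.val_algebraMap]) hf.2⟩

theorem filtration_le (P : Place K F) (V : Submodule K F) (n : ℤ) : P.filtration V n ≤ V :=
  fun _ hf => hf.1

/-- Because the residue field is `K`, subtracting a multiple of `g` raises the order, so each
filtration step has codimension at most one. -/
theorem filtration_le_sup [IsAlgClosed K] (hF : IsFunctionField K F) (P : Place K F)
    {V : Submodule K F} {g : F} (hg : g ∈ V) (hg0 : g ≠ 0) :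
    P.filtration V (P.val g) ≤ P.filtration V (P.val g + 1) ⊔ Submodule.span K {g} := by
  rintro f ⟨hfV, hf⟩
  have hfg : 0 ≤ P.ord (f * g⁻¹) := by
    rcases eq_or_ne f 0 with rfl | hf0
    · simp
    rw [P.val_nonneg_iff, P.val_mul hf0 (inv_ne_zero hg0), P.val_inv]
    rw [P.le_ord_iff hf0] at hf
    omega
  obtain ⟨c, hc⟩ := P.exists_residue hF hfg
  refine Submodule.mem_sup.2 ⟨f - c • g, ⟨V.sub_mem hfV (V.smul_mem c hg), ?_⟩, c • g,
    Submodule.smul_mem _ _ (Submodule.mem_span_singleton_self g), by simp⟩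
  have heq : f - c • g = g * (f * g⁻¹ - algebraMap K F c) := by
    rw [Algebra.smul_def]
    field_simp
  rcases eq_or_ne (f * g⁻¹ - algebraMap K F c) 0 with h0 | h0
  · rw [heq, h0, mul_zero, AddValuation.map_zero]
    exact le_top
  · rw [heq, P.le_ord_iff (mul_ne_zero hg0 h0), P.val_mul hg0 h0]
    rw [P.ord_eq_val h0] at hc
    have : 0 < P.val (f * g⁻¹ - algebraMap K F c) := by exact_mod_cast hc
    omega

theorem filtration_succ_of_forall_ne (P : Place K F) {V : Submodule K F} {n : ℤ}
    (h : ∀ g ∈ V, g ≠ 0 → P.val g ≠ n) : P.filtration V n ≤ P.filtration V (n + 1) := by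
  rintro f ⟨hfV, hf⟩
  refine ⟨hfV, ?_⟩
  rcases eq_or_ne f 0 with rfl | hf0
  · simp
  rw [P.le_ord_iff hf0] at hf ⊢
  have := h f hfV hf0
  omega

theorem finite_filtration_and_finrank_le [IsAlgClosed K] (hF : IsFunctionField K F)
    (P : Place K F) (V : Submodule K F) (n : ℤ) [Module.Finite K (P.filtration V (n + 1))] :
    Module.Finite K (P.filtration V n) ∧
      Module.finrank K (P.filtration V n) ≤ Module.finrank K (P.filtration V (n + 1)) + 1 := by
  by_cases h : ∃ g ∈ V, g ≠ 0 ∧ P.val g = n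
  · obtain ⟨g, hg, hg0, rfl⟩ := h
    have hle := P.filtration_le_sup hF hg hg0
    refine ⟨Submodule.finiteDimensional_of_le hle, (Submodule.finrank_mono hle).trans ?_⟩
    refine (Submodule.finrank_add_le_finrank_add_finrank _ _).trans ?_
    gcongr
    exact finrank_span_singleton hg0 |>.le
  · push Not at h
    have hle := P.filtration_succ_of_forall_ne h
    exact ⟨Submodule.finiteDimensional_of_le hle, (Submodule.finrank_mono hle).trans (by omega)⟩

end Place

namespace CurveDivisor

theorem mem_sections {D : CurveDivisor K F} {f : F} :
    f ∈ D.sections ↔ ∀ P : Place K F, ((-(D P) : ℤ) : WithTop ℤ) ≤ P.ord f := Iff.rfl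

theorem mem_sections_iff_val {D : CurveDivisor K F} {f : F} (hf : f ≠ 0) :
    f ∈ D.sections ↔ ∀ P : Place K F, 0 ≤ P.val f + D P := by
  rw [mem_sections]
  refine forall_congr' fun P => ?_
  rw [P.le_ord_iff hf]
  omega

theorem degree_add (D E : CurveDivisor K F) : (D + E).degree = D.degree + E.degree :=
  Finsupp.sum_add_index' (fun _ => rfl) fun _ _ _ => rfl

theorem degree_single (P : Place K F) (n : ℤ) :
    CurveDivisor.degree (Finsupp.single P n : CurveDivisor K F) = n :=
  Finsupp.sum_single_index rfl

theorem degree_neg (D : CurveDivisor K F) : (-D).degree = -D.degree := by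
  have := degree_add D (-D)
  rw [add_neg_cancel] at this
  have h0 : (0 : CurveDivisor K F).degree = 0 := Finsupp.sum_zero_index
  omega

theorem degree_sub (D E : CurveDivisor K F) : (D - E).degree = D.degree - E.degree := by
  rw [sub_eq_add_neg, degree_add, degree_neg, sub_eq_add_neg]

theorem degree_nsmul (n : ℕ) (D : CurveDivisor K F) : (n • D).degree = n * D.degree := by
  induction n with
  | zero => simp [CurveDivisor.degree]
  | succ n ih => rw [succ_nsmul, degree_add, ih]; push_cast; ring

theorem degree_nonneg {D : CurveDivisor K F} (hD : 0 ≤ D) : 0 ≤ D.degree :=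
  Finset.sum_nonneg fun P _ => hD P

theorem eq_zero_of_degree_eq_zero {D : CurveDivisor K F} (hD : 0 ≤ D) (h : D.degree = 0) :
    D = 0 := by
  have h1 := (Finset.sum_eq_zero_iff_of_nonneg fun P _ => hD P).1 h
  ext P
  by_contra hne
  exact hne (h1 P (Finsupp.mem_support_iff.2 hne))

theorem filtration_sections (D : CurveDivisor K F) (P : Place K F) :
    P.filtration D.sections (-(D P)) = D.sections :=
  le_antisymm (P.filtration_le _ _) fun _ hf => ⟨hf, hf P⟩

theorem filtration_sections_succ (D : CurveDivisor K F) (P : Place K F) :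
    P.filtration D.sections (-(D P) + 1) ≤ (D - Finsupp.single P 1).sections := by
  classical
  rintro f ⟨hf, hfP⟩ Q
  rcases eq_or_ne Q P with rfl | hQ
  · convert hfP using 2
    simp
    ring
  · convert hf Q using 3
    simp [hQ.symm]

theorem sections_zero [IsAlgClosed K] (hF : IsFunctionField K F) :
    (0 : CurveDivisor K F).sections ≤ Submodule.span K {1} := by
  intro f hf
  obtain ⟨c, rfl⟩ := hF.mem_range_of_forall_ord_nonneg (f := f) fun P => by simpa using hf P
  exact Submodule.mem_span_singleton.2 ⟨c, by simp [Algebra.smul_def]⟩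

theorem finite_sections_and_finrank_le [IsAlgClosed K] (hF : IsFunctionField K F)
    {D : CurveDivisor K F} (hD : 0 ≤ D) :
    Module.Finite K D.sections ∧ (Module.finrank K D.sections : ℤ) ≤ D.degree + 1 := by
  classical
  obtain ⟨n, hn⟩ := Int.eq_ofNat_of_zero_le (degree_nonneg hD)
  induction n generalizing D with
  | zero =>
    obtain rfl := eq_zero_of_degree_eq_zero hD hn
    have hle := sections_zero hF
    refine ⟨Submodule.finiteDimensional_of_le hle, ?_⟩
    have h1 := Submodule.finrank_mono hle
    rw [finrank_span_singleton one_ne_zero] at h1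
    rw [hn]
    exact_mod_cast h1
  | succ n ih =>
    obtain ⟨P, hP⟩ : ∃ P, 0 < D P := by
      by_contra! h
      have : D = 0 := by
        ext P
        exact le_antisymm (h P) (hD P)
      simp [this, CurveDivisor.degree] at hn
      omega
    have hdeg : CurveDivisor.degree (D - Finsupp.single P 1) = n := by
      rw [degree_sub, degree_single, hn]
      simp
    have hD' : 0 ≤ D - Finsupp.single P 1 := by
      intro Q
      rcases eq_or_ne Q P with rfl | hQ
      · simpa using Int.add_one_le_iff.2 hP
      · simpa [Finsupp.single_apply, hQ.symm] using hD Q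
    obtain ⟨h1, h2⟩ := ih hD' hdeg
    have hle := filtration_sections_succ D P
    have hfin : Module.Finite K (P.filtration D.sections (-(D P) + 1)) :=
      Submodule.finiteDimensional_of_le hle
    have h3 := P.finite_filtration_and_finrank_le hF D.sections (-(D P))
    rw [filtration_sections] at h3
    refine ⟨h3.1, ?_⟩
    have h4 := Submodule.finrank_mono hle
    have h5 := h3.2
    rw [hdeg] at h2
    rw [hn]
    push_cast
    omega

end CurveDivisor

open scoped IntermediateField.algebraAdjoinAdjoin in
/-- The degree of `F` over `K(f)` is at most the degree of any effective divisor that bounds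
the poles of `f`. -/
theorem finrank_le_degree [IsAlgClosed K] (hF : IsFunctionField K F) {f : F}
    (hf : Transcendental K f) {D : CurveDivisor K F} (hD : 0 ≤ D) (hfD : f ∈ D.sections) :
    (Module.finrank (IntermediateField.adjoin K {f}) F : ℤ) ≤ D.degree := by
  have hfin := hF.finiteDimensional_adjoin hf
  have hf0 : f ≠ 0 := by
    rintro rfl
    exact hf isAlgebraic_zero
  obtain ⟨s, b, hb⟩ := FiniteDimensional.exists_is_basis_integral (Algebra.adjoin K {f})
    (IntermediateField.adjoin K {f}) F
  set m : ℕ := ∑ P ∈ D.support, ∑ i, (P.val (b i)).natAbs with hm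
  -- Off the support of `D` the function `f` is regular, hence so is `b i`, being integral over
  -- `K[f]`; on the support `m` dominates all orders.
  have hbD : ∀ i P, 0 ≤ P.val (b i) + m * D P := by
    intro i P
    rcases (hD P).eq_or_lt with h0 | hpos
    · have hfP : 0 ≤ P.ord f := by simpa [← h0] using hfD P
      have h1 : 0 ≤ P.ord (b i) := by
        refine P.ord_nonneg_of_isIntegral (R := Algebra.adjoin K {f}) (fun r => ?_) (hb i)
        obtain ⟨p, hp⟩ := (Algebra.adjoin_singleton_eq_range_aeval K f).le r.2
        change 0 ≤ P.ord (r : F)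
        rw [← hp]
        exact P.ord_aeval_nonneg hfP p
      rw [P.val_nonneg_iff] at h1
      have h0' : D P = 0 := h0.symm
      rw [h0']
      omega
    · have hpos' : 1 ≤ D P := hpos
      have h1 : (P.val (b i)).natAbs ≤ ∑ i, (P.val (b i)).natAbs :=
        Finset.single_le_sum (f := fun i => (P.val (b i)).natAbs) (fun _ _ => Nat.zero_le _)
          (Finset.mem_univ i)
      have h2 : ∑ i, (P.val (b i)).natAbs ≤ m :=
        Finset.single_le_sum (f := fun P : Place K F => ∑ i, (P.val (b i)).natAbs)
          (fun _ _ => Nat.zero_le _) (Finsupp.mem_support_iff.2 hpos.ne')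
      have h3 : (m : ℤ) ≤ m * D P := by nlinarith
      omega
  -- The products `f ^ j * b i` with `j ≤ k` are independent over `K` and lie in the sections of `(m
  -- + k) D`. Comparing growth in `k` gives the bound.
  have hpow : ∀ k : ℕ, (Module.finrank (IntermediateField.adjoin K {f}) F * (k + 1) : ℤ) ≤
      (m + k) * D.degree + 1 := by
    intro k
    set γ : IntermediateField.adjoin K {f} := IntermediateField.AdjoinSimple.gen K f with hγ
    have hγf : (γ : F) = f := IntermediateField.AdjoinSimple.coe_gen K f
    have hγtr : Transcendental K γ := by
      rw [← hγf] at hf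
      exact (transcendental_algebraMap_iff
        (algebraMap (IntermediateField.adjoin K {f}) F).injective).1 hf
    have hpowind : LinearIndependent K (fun j : ℕ => γ ^ j) := by
      have h1 := (basisMonomials K).linearIndependent.map' (aeval γ).toLinearMap
        (LinearMap.ker_eq_bot.2 (transcendental_iff_injective.1 hγtr))
      have h2 : (aeval γ).toLinearMap ∘ basisMonomials K = fun j : ℕ => γ ^ j := by
        ext j
        simp
      rw [h2] at h1
      exact h1
    have hpowind' : LinearIndependent K (fun j : Fin (k + 1) => γ ^ (j : ℕ)) :=
      hpowind.comp _ Fin.val_injective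
    have hind := linearIndependent_smul hpowind' b.linearIndependent
    have hmem : ∀ p : Fin (k + 1) × s, γ ^ (p.1 : ℕ) • b p.2 ∈ ((m + k) • D).sections := by
      rintro ⟨j, i⟩
      have hbi : b i ≠ 0 := b.ne_zero i
      have heq : γ ^ (j : ℕ) • b i = f ^ (j : ℕ) * b i := by
        rw [IntermediateField.smul_def, smul_eq_mul, IntermediateField.coe_pow, hγf]
      rw [heq, CurveDivisor.mem_sections_iff_val (mul_ne_zero (pow_ne_zero _ hf0) hbi)]
      intro P
      have h1 := (CurveDivisor.mem_sections_iff_val hf0).1 hfD P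
      have h2 := hbD i P
      have h3 : (0 : ℤ) ≤ D P := hD P
      have h4 : ((j : ℕ) : ℤ) ≤ k := by
        have := j.2
        omega
      rw [P.val_mul (pow_ne_zero _ hf0) hbi, P.val_pow hf0, Finsupp.smul_apply, nsmul_eq_mul]
      push_cast
      have h5 : 0 ≤ ((j : ℕ) : ℤ) * (P.val f + D P) := mul_nonneg (by positivity) h1
      nlinarith [mul_nonneg (sub_nonneg.2 h4) h3]
    obtain ⟨hfinD, hle⟩ := CurveDivisor.finite_sections_and_finrank_le hF
      (D := (m + k) • D) (nsmul_nonneg hD _)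
    have hind' : LinearIndependent K
        (fun p => (⟨γ ^ (p.1 : ℕ) • b p.2, hmem p⟩ : ((m + k) • D).sections)) :=
      LinearIndependent.of_comp ((m + k) • D).sections.subtype hind
    have hcard := hind'.fintype_card_le_finrank
    rw [Fintype.card_prod, Fintype.card_fin] at hcard
    rw [Module.finrank_eq_card_basis b]
    rw [CurveDivisor.degree_nsmul] at hle
    push_cast at hle
    have : (((k + 1) * Fintype.card s : ℕ) : ℤ) ≤
        Module.finrank K ((m + k) • D).sections := by exact_mod_cast hcard
    push_cast at this
    linarith
  by_contra! hlt
  set n : ℤ := (Module.finrank (IntermediateField.adjoin K {f}) F : ℤ) with hn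
  have hn0 : 0 < n := by
    rw [hn]
    exact_mod_cast Module.finrank_pos
  -- If `deg D ≤ n - 1`, this `k` is already large enough: the inequality would give `n ≤ -m`.
  have h1 := hpow (m * n.toNat + 1)
  have h2 : ((n.toNat : ℕ) : ℤ) = n := Int.toNat_of_nonneg hn0.le
  push_cast at h1
  rw [h2] at h1
  have h3 : (m + (m * n + 1)) * D.degree ≤ (m + (m * n + 1)) * (n - 1) :=
    mul_le_mul_of_nonneg_left (by omega) (by positivity)
  nlinarith [mul_nonneg (Int.natCast_nonneg m) hn0.le]

/-- For nonconstant `f`, the zeros number at most `[F : K(f)]`, which is at most the degree of the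
pole divisor. So `-div f`, restricted to the support of `B`, has nonnegative degree, and `B`
dominates it. -/
theorem degree_nonneg_of_mem_sections [IsAlgClosed K] (hF : IsFunctionField K F)
    {B : CurveDivisor K F} {f : F} (hf0 : f ≠ 0) (hf : f ∈ B.sections) : 0 ≤ B.degree := by
  have hval := (CurveDivisor.mem_sections_iff_val hf0).1 hf
  by_cases hK : f ∈ (algebraMap K F).range
  · obtain ⟨c, rfl⟩ := hK
    exact CurveDivisor.degree_nonneg fun P => by simpa [P.val_algebraMap] using hval P
  have htr := transcendental_of_not_mem_range hK
  have hfin := hF.finiteDimensional_adjoin htr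
  let D : CurveDivisor K F := Finsupp.onFinset B.support (fun P => max 0 (-P.val f)) fun P hP => by
    have := hval P
    rw [Finsupp.mem_support_iff]
    omega
  have hDapp : ∀ P, D P = max 0 (-P.val f) := fun P => rfl
  have h1 := finrank_le_degree hF htr (D := D) (fun P => le_max_left _ _)
    ((CurveDivisor.mem_sections_iff_val hf0).2 fun P => by rw [hDapp]; omega)
  have h2 := sum_val_le_finrank (t := f) (B.support.filter fun P => 0 < P.val f)
    (fun P hP => (Finset.mem_filter.1 hP).2)
  have h3 : D.degree = ∑ P ∈ B.support, max 0 (-P.val f) :=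
    Finsupp.onFinset_sum _ fun _ => rfl
  have h4 : B.degree = ∑ P ∈ B.support, B P := rfl
  rw [Finset.sum_filter] at h2
  have h5 : ∑ P ∈ B.support, (max 0 (-P.val f) - if 0 < P.val f then P.val f else 0) ≤
      ∑ P ∈ B.support, B P := by
    refine Finset.sum_le_sum fun P _ => ?_
    have := hval P
    split_ifs <;> omega
  rw [Finset.sum_sub_distrib] at h5
  omega

theorem val_eq_neg_of_degree_eq_zero [IsAlgClosed K] (hF : IsFunctionField K F)
    {B : CurveDivisor K F} {f : F} (hf0 : f ≠ 0) (hf : f ∈ B.sections) (hB : B.degree = 0)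
    (P : Place K F) : P.val f = -B P := by
  classical
  have hval := (CurveDivisor.mem_sections_iff_val hf0).1 hf
  by_contra hne
  -- A surplus zero at `P` would make `f` a section of a bundle of degree `-1`.
  have h1 := degree_nonneg_of_mem_sections hF (B := B - Finsupp.single P 1) hf0
    ((CurveDivisor.mem_sections_iff_val hf0).2 fun Q => by
      have := hval Q
      rcases eq_or_ne Q P with rfl | hQ
      · simp
        omega
      · simpa [Finsupp.single_apply, hQ.symm] using this)
  rw [CurveDivisor.degree_sub, CurveDivisor.degree_single, hB] at h1
  omega

end Degree

/-! ### Vanishing sequences of linear series -/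

section Series

variable {K F : Type*} [Field K] [Field F] [Algebra K F] {r m : ℕ}

namespace LinearSeries

theorem finite (S : LinearSeries K F r m) : Module.Finite K S.V :=
  Module.finite_of_finrank_pos (by rw [S.finrank_eq]; omega)

theorem isVanishingOrder_iff (S : LinearSeries K F r m) (P : Place K F) (k : ℕ) :
    S.IsVanishingOrder P k ↔ ∃ f ∈ S.V, f ≠ 0 ∧ P.val f = k - S.A P := by
  constructor
  · rintro ⟨f, hf, h⟩
    have hf0 : f ≠ 0 := by
      rintro rfl
      rw [AddValuation.map_zero] at h
      exact WithTop.top_ne_coe h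
    exact ⟨f, hf, hf0, (P.ord_eq_iff hf0).1 h⟩
  · rintro ⟨f, hf, hf0, h⟩
    exact ⟨f, hf, (P.ord_eq_iff hf0).2 h⟩

theorem val_add_le [IsAlgClosed K] (hF : IsFunctionField K F) (S : LinearSeries K F r m)
    (P : Place K F) {f : F} (hf : f ∈ S.V) (hf0 : f ≠ 0) : P.val f + S.A P ≤ m := by
  classical
  have h := degree_nonneg_of_mem_sections hF
    (B := S.A - Finsupp.single P (P.val f + S.A P)) hf0
    ((CurveDivisor.mem_sections_iff_val hf0).2 fun Q => by
      rcases eq_or_ne Q P with rfl | hQ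
      · simp
      · simpa [hQ.symm] using
          (CurveDivisor.mem_sections_iff_val hf0).1 (S.le_sections hf) Q)
  rw [CurveDivisor.degree_sub, CurveDivisor.degree_single, S.degree_eq] at h
  omega

open Classical in
-- The filtration by order drops by exactly one dimension after `k` when `k` is a vanishing order,
-- and stays constant otherwise.
theorem finrank_filtration_add_count [IsAlgClosed K] (hF : IsFunctionField K F)
    (S : LinearSeries K F r m) (P : Place K F) (k : ℕ) :
    Module.finrank K (P.filtration S.V (k - S.A P)) + Nat.count (S.IsVanishingOrder P) k =
      r + 1 := by
  have := S.finite
  have hfin : ∀ n, Module.Finite K (P.filtration S.V n) := fun n =>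
    Submodule.finiteDimensional_of_le (P.filtration_le S.V n)
  induction k with
  | zero =>
    have h : P.filtration S.V ((0 : ℕ) - S.A P) = S.V :=
      le_antisymm (P.filtration_le _ _) fun f hf => ⟨hf, by simpa using S.le_sections hf P⟩
    rw [h, S.finrank_eq, Nat.count_zero]
  | succ k ih =>
    have hcast : ((k + 1 : ℕ) : ℤ) - S.A P = (k - S.A P) + 1 := by push_cast; ring
    rw [hcast, Nat.count_succ]
    have hle : P.filtration S.V (k - S.A P + 1) ≤ P.filtration S.V (k - S.A P) :=
      fun f hf => ⟨hf.1, le_trans (by exact_mod_cast (by omega)) hf.2⟩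
    split_ifs with hk
    · have hk' := hk
      rw [isVanishingOrder_iff] at hk'
      obtain ⟨f, hf, hf0, hfk⟩ := hk'
      have hlt : P.filtration S.V (k - S.A P + 1) < P.filtration S.V (k - S.A P) := by
        refine lt_of_le_of_ne hle fun heq => ?_
        have hmem : f ∈ P.filtration S.V (k - S.A P) := ⟨hf, by rw [P.le_ord_iff hf0, hfk]⟩
        rw [← heq] at hmem
        have := (P.le_ord_iff hf0).1 hmem.2
        omega
      have h1 := Submodule.finrank_lt_finrank_of_lt hlt
      have h2 := (P.finite_filtration_and_finrank_le hF S.V (k - S.A P)).2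
      omega
    · have h1 : P.filtration S.V (k - S.A P + 1) = P.filtration S.V (k - S.A P) :=
        le_antisymm hle (P.filtration_succ_of_forall_ne fun g hg hg0 h =>
          hk ((S.isVanishingOrder_iff P k).2 ⟨g, hg, hg0, h⟩))
      rw [h1]
      omega

theorem IsVanishingOrder.le [IsAlgClosed K] (hF : IsFunctionField K F)
    {S : LinearSeries K F r m} {P : Place K F} {k : ℕ} (h : S.IsVanishingOrder P k) : k ≤ m := by
  rw [isVanishingOrder_iff] at h
  obtain ⟨f, hf, hf0, hfk⟩ := h
  have := S.val_add_le hF P hf hf0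
  omega

open Classical in
theorem count_eq [IsAlgClosed K] (hF : IsFunctionField K F)
    (S : LinearSeries K F r m) (P : Place K F) :
    Nat.count (S.IsVanishingOrder P) (m + 1) = r + 1 := by
  have h := S.finrank_filtration_add_count hF P (m + 1)
  have h0 : P.filtration S.V ((m + 1 : ℕ) - S.A P) = ⊥ := by
    rw [eq_bot_iff]
    rintro f ⟨hf, hfm⟩
    by_contra hf0
    rw [P.le_ord_iff hf0] at hfm
    have := S.val_add_le hF P hf hf0
    push_cast at hfm
    omega
  rwa [h0, finrank_bot, zero_add] at h

/-- This guarantees that `van` at an index up to `r` is a genuine vanishing order and not the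
default value of `Nat.nth`. -/
theorem card_isVanishingOrder [IsAlgClosed K] (hF : IsFunctionField K F)
    (S : LinearSeries K F r m) (P : Place K F) (hfin : (Set.ofPred (S.IsVanishingOrder P)).Finite) :
    hfin.toFinset.card = r + 1 := by
  classical
  rw [← S.count_eq hF P, Nat.count_eq_card_filter_range]
  congr 1
  ext k
  simp only [Set.Finite.mem_toFinset, Set.mem_ofPred_eq, Finset.mem_filter, Finset.mem_range]
  exact ⟨fun h => ⟨by have := h.le hF; omega, h⟩, fun h => h.2⟩

theorem isVanishingOrder_van [IsAlgClosed K] (hF : IsFunctionField K F)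
    (S : LinearSeries K F r m) (P : Place K F) {i : ℕ} (hi : i ≤ r) :
    S.IsVanishingOrder P (S.van P i) :=
  Nat.nth_mem i fun hfin => by rw [S.card_isVanishingOrder hF P]; omega

theorem van_lt_van [IsAlgClosed K] (hF : IsFunctionField K F)
    (S : LinearSeries K F r m) (P : Place K F) {i j : ℕ} (hij : i < j) (hj : j ≤ r) :
    S.van P i < S.van P j :=
  Nat.nth_lt_nth' hij fun hfin => by rw [S.card_isVanishingOrder hF P]; omega

theorem exists_van_eq [IsAlgClosed K] (hF : IsFunctionField K F)
    (S : LinearSeries K F r m) (P : Place K F) {k : ℕ} (hk : S.IsVanishingOrder P k) :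
    ∃ i ≤ r, S.van P i = k := by
  classical
  refine ⟨Nat.count (S.IsVanishingOrder P) k, ?_, Nat.nth_count hk⟩
  have h1 := Nat.count_strict_mono hk (Nat.lt_add_one_of_le (hk.le hF))
  have h2 := S.count_eq hF P
  omega

theorem finrank_filtration_van [IsAlgClosed K] (hF : IsFunctionField K F)
    (S : LinearSeries K F r m) (P : Place K F) {i : ℕ} (hi : i ≤ r) :
    Module.finrank K (P.filtration S.V (S.van P i - S.A P)) + i = r + 1 := by
  classical
  have h := S.finrank_filtration_add_count hF P (S.van P i)
  rwa [van, Nat.count_nth fun hfin => by rw [S.card_isVanishingOrder hF P]; omega] at h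

/-- There is a section vanishing to the orders `a_i` and `b_{r-i}` at two points. -/
theorem exists_section [IsAlgClosed K] (hF : IsFunctionField K F)
    (S : LinearSeries K F r m) (P : Place K F) {Q : Place K F} (hPQ : P ≠ Q) {D D' : CurveDivisor K F}
    (hD : S.V ≤ CurveDivisor.sections (S.A - D)) (hD' : D' ≤ D) (hP : D' P = 0) (hQ : D' Q = 0)
    {i : ℕ} (hi : i ≤ r) : ∃ f : F, f ≠ 0 ∧ f ∈ CurveDivisor.sections
      (S.A - D' - Finsupp.single P (S.van P i : ℤ) - Finsupp.single Q (S.van Q (r - i) : ℤ)) := by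
  classical
  have hfin := S.finite
  set W₁ := P.filtration S.V (S.van P i - S.A P)
  set W₂ := Q.filtration S.V (S.van Q (r - i) - S.A Q)
  have h1 : Module.finrank K W₁ + i = r + 1 := S.finrank_filtration_van hF P hi
  have h2 : Module.finrank K W₂ + (r - i) = r + 1 :=
    S.finrank_filtration_van hF Q (Nat.sub_le r i)
  have hf1 : Module.Finite K W₁ := Submodule.finiteDimensional_of_le (P.filtration_le S.V _)
  have hf2 : Module.Finite K W₂ := Submodule.finiteDimensional_of_le (Q.filtration_le S.V _)
  have h3 := Submodule.finrank_sup_add_finrank_inf_eq W₁ W₂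
  have h4 := Submodule.finrank_mono (sup_le (P.filtration_le S.V _) (Q.filtration_le S.V _) :
    W₁ ⊔ W₂ ≤ S.V)
  rw [S.finrank_eq] at h4
  -- The dimensions `r + 1 - i` and `i + 1` add up to more than `r + 1`.
  have h5 : W₁ ⊓ W₂ ≠ ⊥ := by
    intro h
    rw [h, finrank_bot] at h3
    omega
  obtain ⟨f, ⟨hfP, hfQ⟩, hf0⟩ := Submodule.exists_mem_ne_zero_of_ne_bot h5
  refine ⟨f, hf0, (CurveDivisor.mem_sections_iff_val hf0).2 fun R => ?_⟩
  have hRD := (CurveDivisor.mem_sections_iff_val hf0).1 (hD hfP.1) R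
  have hRD' : D' R ≤ D R := hD' R
  have hP' := (P.le_ord_iff hf0).1 hfP.2
  have hQ' := (Q.le_ord_iff hf0).1 hfQ.2
  simp only [Finsupp.sub_apply] at hRD ⊢
  rcases eq_or_ne R P with rfl | hRP
  · simp [hPQ.symm, hP]
    omega
  rcases eq_or_ne R Q with rfl | hRQ
  · simp [hPQ, hQ]
    omega
  simp [hRP.symm, hRQ.symm]
  omega

theorem van_add_van_add_degree_le [IsAlgClosed K] (hF : IsFunctionField K F)
    (S : LinearSeries K F r m) (P : Place K F) {Q : Place K F} (hPQ : P ≠ Q) {D D' : CurveDivisor K F}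
    (hD : S.V ≤ CurveDivisor.sections (S.A - D)) (hD' : D' ≤ D) (hP : D' P = 0) (hQ : D' Q = 0)
    {i : ℕ} (hi : i ≤ r) : (S.van P i : ℤ) + S.van Q (r - i) + D'.degree ≤ m := by
  obtain ⟨f, hf0, hf⟩ := S.exists_section hF P hPQ hD hD' hP hQ hi
  have := degree_nonneg_of_mem_sections hF hf0 hf
  simp only [CurveDivisor.degree_sub, CurveDivisor.degree_single, S.degree_eq] at this
  omega

theorem isPrincipal_of_van_add_van [IsAlgClosed K] (hF : IsFunctionField K F)
    (S : LinearSeries K F r m) (P : Place K F) {Q : Place K F} (hPQ : P ≠ Q) {D D' : CurveDivisor K F}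
    (hD : S.V ≤ CurveDivisor.sections (S.A - D)) (hD' : D' ≤ D) (hP : D' P = 0) (hQ : D' Q = 0)
    {i : ℕ} (hi : i ≤ r) (h : (S.van P i : ℤ) + S.van Q (r - i) + D'.degree = m) :
    CurveDivisor.IsPrincipal
      (Finsupp.single P (S.van P i : ℤ) + Finsupp.single Q (S.van Q (r - i) : ℤ) +
        (D' - S.A) : CurveDivisor K F) := by
  obtain ⟨f, hf0, hf⟩ := S.exists_section hF P hPQ hD hD' hP hQ hi
  refine ⟨f, hf0, fun R => ?_⟩
  rw [R.ord_eq_iff hf0, val_eq_neg_of_degree_eq_zero hF hf0 hf (by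
    simp only [CurveDivisor.degree_sub, CurveDivisor.degree_single, S.degree_eq]
    omega)]
  simp only [Finsupp.sub_apply, Finsupp.add_apply]
  ring

end LinearSeries

/-- The quotient of the two functions has divisor `(a - a')(P - Q)`, and `P - Q` is nontorsion. -/
theorem CurveDivisor.eq_of_isPrincipal {P Q : Place K F}
    (hgen : ∀ k : ℕ, 0 < k → ¬ CurveDivisor.IsPrincipal
      (Finsupp.single P (k : ℤ) - Finsupp.single Q (k : ℤ) : CurveDivisor K F))
    {E : CurveDivisor K F} {a b a' b' : ℤ} (hab : a + b = a' + b')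
    (h : CurveDivisor.IsPrincipal (Finsupp.single P a + Finsupp.single Q b + E))
    (h' : CurveDivisor.IsPrincipal (Finsupp.single P a' + Finsupp.single Q b' + E)) :
    a = a' := by
  classical
  have key : ∀ {a b a' b' : ℤ}, a + b = a' + b' →
      CurveDivisor.IsPrincipal (Finsupp.single P a + Finsupp.single Q b + E) →
      CurveDivisor.IsPrincipal (Finsupp.single P a' + Finsupp.single Q b' + E) → a ≤ a' := by
    rintro a b a' b' hab ⟨f, hf0, hf⟩ ⟨f', hf0', hf'⟩
    by_contra! hlt
    refine hgen (a - a').toNat (by omega)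
      ⟨f * f'⁻¹, mul_ne_zero hf0 (inv_ne_zero hf0'), fun R => ?_⟩
    have h1 := (R.ord_eq_iff hf0).1 (hf R)
    have h2 := (R.ord_eq_iff hf0').1 (hf' R)
    rw [R.ord_eq_iff (mul_ne_zero hf0 (inv_ne_zero hf0')), R.val_mul hf0 (inv_ne_zero hf0'),
      R.val_inv, h1, h2]
    simp only [Finsupp.sub_apply, Finsupp.add_apply, Finsupp.single_apply]
    split_ifs <;> omega
  exact le_antisymm (key hab h h') (key hab.symm h' h)

end Series

/-! ### Combinatorics of the cyclic word -/

section Combinatorics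

/-- The `i`-th vanishing order at the first marked point of the `j`-th component of the limit
series with `ρ = 0` and word type `(12⋯(s+1))^u`. -/
def cyclicOrder (s j i : ℕ) : ℤ :=
  i + j - (j / (s + 1) : ℕ) - if i < j % (s + 1) then 1 else 0

theorem cyclicOrder_zero (s i : ℕ) : cyclicOrder s 0 i = i := by
  simp [cyclicOrder]

theorem cyclicOrder_mul (s u i : ℕ) : cyclicOrder s (u * (s + 1)) i = i + u * s := by
  simp only [cyclicOrder, Nat.mul_mod_left, Nat.not_lt_zero, if_false,
    Nat.mul_div_cancel u (Nat.succ_pos s)]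
  push_cast
  ring

/-- Every order rises by one across a component, except the one named by its letter; after a full
period each index has paused once. -/
theorem cyclicOrder_succ {s j i : ℕ} (hi : i ≤ s) :
    cyclicOrder s (j + 1) i = cyclicOrder s j i + if i = j % (s + 1) then 0 else 1 := by
  have h1 := Nat.div_add_mod j (s + 1)
  have h2 : j % (s + 1) < s + 1 := Nat.mod_lt j (Nat.succ_pos s)
  rcases (Nat.lt_add_one_iff.1 h2).eq_or_lt with hc | hc
  · have h3 : (j + 1) / (s + 1) = j / (s + 1) + 1 ∧ (j + 1) % (s + 1) = 0 := by
      refine (Nat.div_mod_unique (Nat.add_one_pos s)).2 ⟨?_, Nat.add_one_pos s⟩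
      rw [mul_add]
      omega
    simp only [cyclicOrder, h3.1, h3.2]
    push_cast
    split_ifs <;> omega
  · have h3 : (j + 1) / (s + 1) = j / (s + 1) ∧ (j + 1) % (s + 1) = j % (s + 1) + 1 := by
      refine (Nat.div_mod_unique (Nat.add_one_pos s)).2 ⟨?_, by omega⟩
      omega
    simp only [cyclicOrder, h3.1, h3.2]
    push_cast
    split_ifs <;> omega

theorem cyclicOrder_lt {s j i k : ℕ} (h : i < k) : cyclicOrder s j i < cyclicOrder s j k := by
  simp only [cyclicOrder]
  split_ifs <;> omega

theorem cyclicOrder_le_iff {s j i k : ℕ} : cyclicOrder s j i ≤ cyclicOrder s j k ↔ i ≤ k := by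
  constructor
  · intro h
    by_contra! hlt
    exact absurd (cyclicOrder_lt (s := s) (j := j) hlt) (not_lt.2 h)
  · intro h
    rcases h.eq_or_lt with rfl | h
    · rfl
    · exact (cyclicOrder_lt h).le

theorem cyclicOrder_inj {s j i k : ℕ} (h : cyclicOrder s j i = cyclicOrder s j k) : i = k :=
  le_antisymm (cyclicOrder_le_iff.1 h.le) (cyclicOrder_le_iff.1 h.ge)

/-- The least total shift of the indices `σ i` of the included series on a component that carries
`e` base points. -/
theorem le_sum_shift {s j n e : ℕ} {σ τ : ℕ → ℕ} (hσs : ∀ i ≤ n, σ i ≤ s) (hτs : ∀ i ≤ n, τ i ≤ s)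
    (hσ : ∀ i ≤ n, ∀ k ≤ n, σ i = σ k → i = k)
    (h : ∀ i ≤ n, cyclicOrder s j (σ i) + e ≤ cyclicOrder s (j + 1) (τ i))
    (huniq : ∀ i ≤ n, ∀ k ≤ n, cyclicOrder s j (σ i) + e = cyclicOrder s (j + 1) (τ i) →
      cyclicOrder s j (σ k) + e = cyclicOrder s (j + 1) (τ k) → i = k)
    (hzero : e = 0 → ∀ i ≤ n, cyclicOrder s j (σ i) + e = cyclicOrder s (j + 1) (τ i) →
      σ i = j % (s + 1)) :
    (n * e + (if 2 ≤ e then 1 else 0) : ℤ) ≤ ∑ i ∈ Finset.range (n + 1), ((τ i : ℤ) - σ i) := by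
  set c := j % (s + 1) with hc
  -- The correction `δ` marks the at most one index where the degree bound is attained.
  let δ : ℕ → ℤ := fun i =>
    if cyclicOrder s j (σ i) + e = cyclicOrder s (j + 1) (τ i) then 1 else 0
  -- The orders at `p` have a gap just below index `c`, those at `q` a gap just above it. An index
  -- jumping across both gaps needs one step less; `χ` marks where this can happen.
  let χ : ℕ → ℤ := fun i => if σ i < c ∧ c + 2 ≤ σ i + e then 1 else 0
  have hδ : ∑ i ∈ Finset.range (n + 1), δ i ≤ 1 := by
    rw [Finset.sum_boole]
    have : (Finset.filter (fun i => cyclicOrder s j (σ i) + e = cyclicOrder s (j + 1) (τ i))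
        (Finset.range (n + 1))).card ≤ 1 := by
      refine Finset.card_le_one.2 fun i hi k hk => ?_
      rw [Finset.mem_filter, Finset.mem_range] at hi hk
      exact huniq i (by omega) k (by omega) hi.2 hk.2
    exact_mod_cast this
  -- The map `σ` is injective and the marked values lie in a window of length at most `e - 2`
  -- (truncated). So for `e ≥ 2` the total is at least `(n + 1) e - 1 - (e - 2) = n e + 1`, whereas
  -- `e = 1` allows `n`.
  have hχ : ∑ i ∈ Finset.range (n + 1), χ i ≤ (e - 2 : ℕ) := by
    rw [Finset.sum_boole]
    have : (Finset.filter (fun i => σ i < c ∧ c + 2 ≤ σ i + e) (Finset.range (n + 1))).card ≤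
        (Finset.Ico (c + 2 - e) c).card := by
      refine Finset.card_le_card_of_injOn σ (fun i hi => ?_) (fun i hi k hk hik => ?_)
      · simp only [Finset.coe_filter, Finset.mem_range, Set.mem_ofPred_eq, Finset.coe_Ico,
          Set.mem_Ico] at hi ⊢
        omega
      · simp only [Finset.coe_filter, Finset.mem_range, Set.mem_ofPred_eq] at hi hk
        exact hσ i (by omega) k (by omega) hik
    rw [Nat.card_Ico] at this
    have h2 : c - (c + 2 - e) ≤ e - 2 := by omega
    exact_mod_cast this.trans h2
  -- For `e = 0` a backward shift would need equality at an index other than `c`, which `hzero`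
  -- forbids.
  have hpt : ∀ i ∈ Finset.range (n + 1),
      (if e = 0 then 0 else (e : ℤ) - δ i - χ i) ≤ (τ i : ℤ) - σ i := by
    intro i hi
    have hin : i ≤ n := by
      rw [Finset.mem_range] at hi
      omega
    have h1 := h i hin
    have h2 := hσs i hin
    have h3 := hτs i hin
    have h4 := fun h0 => hzero h0 i hin
    simp only [δ, χ]
    rw [cyclicOrder_succ h3] at h1 h4 ⊢
    simp only [cyclicOrder, ← hc] at h1 h4 ⊢
    split_ifs at h1 h4 ⊢ <;> omega
  have hsum := Finset.sum_le_sum hpt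
  rcases Nat.eq_zero_or_pos e with he | he
  · simp only [he, if_true, Finset.sum_const_zero] at hsum
    simpa [he] using hsum
  · simp only [he.ne', if_false, Finset.sum_sub_distrib, Finset.sum_const, Finset.card_range,
      nsmul_eq_mul] at hsum
    simp only [Finset.sum_sub_distrib]
    push_cast at hsum
    split_ifs with h2
    · have : ((e - 2 : ℕ) : ℤ) = e - 2 := by omega
      linarith
    · have : ((e - 2 : ℕ) : ℤ) = 0 := by omega
      have he1 : (e : ℤ) = 1 := by omega
      rw [he1] at hsum ⊢
      linarith

theorem sum_sub_le_of_le_succ {g : ℕ} (T S : Fin g → ℤ)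
    (h : ∀ j j' : Fin g, (j' : ℕ) = j + 1 → T j ≤ S j') (j₀ j₁ : Fin g) (h₀ : (j₀ : ℕ) = 0)
    (h₁ : (j₁ : ℕ) + 1 = g) : ∑ j, (T j - S j) ≤ T j₁ - S j₀ := by
  cases g with
  | zero => exact j₀.elim0
  | succ n =>
    have e₀ : j₀ = 0 := Fin.ext h₀
    have e₁ : j₁ = Fin.last n := Fin.ext (by simpa using h₁)
    rw [Finset.sum_sub_distrib, Fin.sum_univ_castSucc, Fin.sum_univ_succ S, e₀, e₁]
    have : ∑ i : Fin n, T i.castSucc ≤ ∑ i : Fin n, S i.succ :=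
      Finset.sum_le_sum fun i _ => h _ _ (by simp)
    linarith

end Combinatorics

theorem CurveDivisor.eq_zero_or_eq_single {K F : Type*} [Field K] [Field F] [Algebra K F]
    {D : CurveDivisor K F} (hD : 0 ≤ D) (h : D.degree ≤ 1) :
    D = 0 ∨ ∃ P, D = Finsupp.single P 1 := by
  classical
  by_cases h0 : D = 0
  · exact Or.inl h0
  right
  obtain ⟨P, hP⟩ : ∃ P, 0 < D P := by
    by_contra! hn
    exact h0 (Finsupp.ext fun P => le_antisymm (hn P) (hD P))
  have hD' : 0 ≤ D - Finsupp.single P 1 := by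
    intro Q
    rcases eq_or_ne Q P with rfl | hQ
    · simpa using Int.add_one_le_iff.2 hP
    · simpa [Finsupp.single_apply, hQ.symm] using hD Q
  have h1 := degree_nonneg hD'
  have h2 : CurveDivisor.degree (D - Finsupp.single P 1) = D.degree - 1 := by
    rw [degree_sub, degree_single]
  exact ⟨P, sub_eq_zero.1 (eq_zero_of_degree_eq_zero hD' (by omega))⟩

/-- Base multiplicity at `P` or `Q` is already contained in the vanishing orders there; only the
remaining part adds to `a_i + b_{r-i}`. -/
theorem CurveDivisor.exists_off_points {K F : Type*} [Field K] [Field F] [Algebra K F]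
    {D : CurveDivisor K F} (hD : 0 ≤ D) {P Q : Place K F} (hPQ : P ≠ Q) :
    ∃ D' : CurveDivisor K F, 0 ≤ D' ∧ D' ≤ D ∧ D' P = 0 ∧ D' Q = 0 ∧
      D.degree = D'.degree + D P + D Q := by
  classical
  have happ : ∀ R, (D - Finsupp.single P (D P) - Finsupp.single Q (D Q)) R =
      if R = P then 0 else if R = Q then 0 else D R := by
    intro R
    rcases eq_or_ne R P with rfl | hP
    · simp [hPQ.symm]
    rcases eq_or_ne R Q with rfl | hQ
    · simp [hP]
    · simp [hP, hQ]
  refine ⟨D - Finsupp.single P (D P) - Finsupp.single Q (D Q), fun R => ?_, fun R => ?_, ?_, ?_, ?_⟩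
  · have := hD R
    rw [happ, Finsupp.zero_apply]
    rw [Finsupp.zero_apply] at this
    split_ifs <;> omega
  · have := hD R
    rw [Finsupp.zero_apply] at this
    rw [happ]
    split_ifs <;> omega
  · simp [happ]
  · simp [happ]
  · rw [degree_sub, degree_sub, degree_single, degree_single]
    ring

/-! ### Rigidity of the ambient series -/

section ChainSeries

variable {K : Type*} [Field K] {g : ℕ} {F : Fin g → Type*} [∀ j, Field (F j)]
  [∀ j, Algebra K (F j)] {X : EllipticChain K F} {s m u : ℕ}

theorem EllipticChain.isFunctionField (X : EllipticChain K F) (j : Fin g) :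
    IsFunctionField K (F j) :=
  .of_isEllipticFunctionField (X.isElliptic j)

variable [IsAlgClosed K]

theorem LinearSeries.le_van {F : Type*} [Field F] [Algebra K F] (hF : IsFunctionField K F)
    (S : LinearSeries K F s m) (P : Place K F) {x : ℕ} (hx : x ≤ S.van P 0) {i : ℕ} (hi : i ≤ s) :
    i + x ≤ S.van P i := by
  induction i with
  | zero => simpa using hx
  | succ i ih =>
    have h1 := ih (by omega)
    have h2 := S.van_lt_van hF P (Nat.lt_add_one i) hi
    omega

namespace LimitLinearSeries

/-- The letter of the component already attains the total `m`, and nontorsion allows only one index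
to do so; all others lose at least one. -/
theorem van_add_van_le (hX : X.IsGeneral) (S : LimitLinearSeries X s m)
    {w : Fin g → Fin (s + 1)} (hw : S.HasWordType w) (j : Fin g) {i : ℕ} (hi : i ≤ s) :
    ((S.aspect j).van (X.p j) i : ℤ) + (S.aspect j).van (X.q j) (s - i) +
      (if i = w j then 0 else 1) ≤ m := by
  have hF := X.isFunctionField j
  have hD : (S.aspect j).V ≤ CurveDivisor.sections ((S.aspect j).A - 0) := by
    rw [sub_zero]
    exact (S.aspect j).le_sections
  have h0 : (0 : CurveDivisor K (F j)).degree = 0 := Finsupp.sum_zero_index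
  have h1 := (S.aspect j).van_add_van_add_degree_le hF (X.p j) (X.p_ne_q j) hD le_rfl rfl rfl hi
  rw [h0, add_zero] at h1
  split_ifs with hiw
  · simpa using h1
  refine Int.add_one_le_iff.2 (lt_of_le_of_ne h1 fun heq => hiw ?_)
  have hwj : (w j : ℕ) ≤ s := Nat.lt_succ_iff.1 (w j).2
  have hwm : ((S.aspect j).van (X.p j) (w j) : ℤ) + (S.aspect j).van (X.q j) (s - w j) = m := by
    exact_mod_cast hw j
  have h2 := (S.aspect j).isPrincipal_of_van_add_van hF (X.p j) (X.p_ne_q j) hD le_rfl rfl rfl hi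
    (by rw [h0, add_zero, heq])
  have h3 := (S.aspect j).isPrincipal_of_van_add_van hF (X.p j) (X.p_ne_q j) hD le_rfl rfl rfl hwj
    (by rw [h0, add_zero, hwm])
  have h4 : (S.aspect j).van (X.p j) i = (S.aspect j).van (X.p j) (w j) := by
    exact_mod_cast CurveDivisor.eq_of_isPrincipal (hX j) (heq.trans hwm.symm) h2 h3
  rcases lt_trichotomy i (w j) with h | h | h
  · have := (S.aspect j).van_lt_van hF (X.p j) h hwj
    omega
  · exact h
  · have := (S.aspect j).van_lt_van hF (X.p j) h hi
    omega

/-- Propagation from the left end, where `a_i ≥ i`. -/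
theorem cyclicOrder_le_van (hX : X.IsGeneral) (S : LimitLinearSeries X s m)
    (hS : S.HasWordType (cyclicWord g s)) (n : ℕ) (hn : n < g) {i : ℕ} (hi : i ≤ s) :
    cyclicOrder s n i ≤ (S.aspect ⟨n, hn⟩).van (X.p ⟨n, hn⟩) i := by
  induction n with
  | zero =>
    rw [cyclicOrder_zero]
    exact_mod_cast (S.aspect _).le_van (X.isFunctionField _) (X.p _) (Nat.zero_le _) hi
  | succ n ih =>
    have h1 := ih (by omega)
    have h2 := S.van_add_van_le hX hS ⟨n, by omega⟩ hi
    have h3 := S.compatible ⟨n, by omega⟩ ⟨n + 1, hn⟩ rfl i hi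
    rw [cyclicOrder_succ hi]
    simp only [cyclicWord] at h2
    omega

/-- Propagation from the right end, where `b_{s-i} ≥ s - i`. The value `m = s + us` makes this upper
bound coincide with the lower bound from the left. -/
theorem sub_van_le_cyclicOrder (hg : g = u * (s + 1)) (hm : (m : ℤ) = s + u * s)
    (hX : X.IsGeneral) (S : LimitLinearSeries X s m)
    (hS : S.HasWordType (cyclicWord g s)) (n : ℕ) (j : Fin g) (hn : (j : ℕ) + n + 1 = g) {i : ℕ}
    (hi : i ≤ s) :
    m - (S.aspect j).van (X.q j) (s - i) ≤ cyclicOrder s (j + 1) i := by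
  induction n generalizing j with
  | zero =>
    have h1 : (j : ℕ) + 1 = u * (s + 1) := by omega
    rw [h1, cyclicOrder_mul]
    have := (S.aspect j).le_van (X.isFunctionField j) (X.q j) (Nat.zero_le _) (Nat.sub_le s i)
    omega
  | succ n ih =>
    have h1 := ih ⟨j + 1, by omega⟩ (by simp only; omega)
    have h2 := S.van_add_van_le hX hS ⟨j + 1, by omega⟩ hi
    have h3 := S.compatible j ⟨j + 1, by omega⟩ rfl i hi
    simp only at h1
    rw [cyclicOrder_succ hi] at h1
    simp only [cyclicWord] at h2
    omega

theorem van_p_eq (hg : g = u * (s + 1)) (hm : (m : ℤ) = s + u * s)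
    (hX : X.IsGeneral) (S : LimitLinearSeries X s m)
    (hS : S.HasWordType (cyclicWord g s)) (j : Fin g) {i : ℕ} (hi : i ≤ s) :
    ((S.aspect j).van (X.p j) i : ℤ) = cyclicOrder s j i := by
  have h1 := S.cyclicOrder_le_van hX hS j j.2 hi
  have h2 := S.sub_van_le_cyclicOrder hg hm hX hS (g - 1 - j) j (by omega) hi
  have h3 := S.van_add_van_le hX hS j hi
  rw [cyclicOrder_succ hi] at h2
  simp only [cyclicWord, Fin.eta] at h1 h3
  omega

theorem van_q_eq (hg : g = u * (s + 1)) (hm : (m : ℤ) = s + u * s)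
    (hX : X.IsGeneral) (S : LimitLinearSeries X s m)
    (hS : S.HasWordType (cyclicWord g s)) (j : Fin g) {i : ℕ} (hi : i ≤ s) :
    ((S.aspect j).van (X.q j) (s - i) : ℤ) = m - cyclicOrder s (j + 1) i := by
  have h1 := S.cyclicOrder_le_van hX hS j j.2 hi
  have h2 := S.sub_van_le_cyclicOrder hg hm hX hS (g - 1 - j) j (by omega) hi
  have h3 := S.van_add_van_le hX hS j hi
  rw [cyclicOrder_succ hi] at h2 ⊢
  simp only [cyclicWord, Fin.eta] at h1 h3
  omega

end LimitLinearSeries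

end ChainSeries

/-! ### Index shifts of the included series -/

section Inclusion

variable {K : Type*} [Field K] [IsAlgClosed K] {g : ℕ} {F : Fin g → Type*} [∀ j, Field (F j)]
  [∀ j, Algebra K (F j)] {X : EllipticChain K F} {s r₂ m d u : ℕ}

theorem LinearSeries.IsVanishingOrder.mono {K F : Type*} [Field K] [Field F] [Algebra K F]
    {r r' m : ℕ} {S : LinearSeries K F r m} {S' : LinearSeries K F r' m} (hA : S'.A = S.A)
    (hV : S'.V ≤ S.V) {P : Place K F} {k : ℕ} (h : S'.IsVanishingOrder P k) :
    S.IsVanishingOrder P k := by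
  obtain ⟨f, hf, hk⟩ := h
  exact ⟨f, hV hf, by rw [hk, hA]⟩

theorem LinearSeries.le_of_isVanishingOrder {K F : Type*} [Field K] [Field F] [Algebra K F]
    {r m : ℕ} {S : LinearSeries K F r m} {D : CurveDivisor K F}
    (hD : S.V ≤ CurveDivisor.sections (S.A - D)) {P : Place K F} {k : ℕ}
    (h : S.IsVanishingOrder P k) : D P ≤ k := by
  obtain ⟨f, hf, hf0, hk⟩ := (S.isVanishingOrder_iff P k).1 h
  have := (CurveDivisor.mem_sections_iff_val hf0).1 (hD hf) P
  rw [hk, Finsupp.sub_apply] at this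
  omega

namespace InclusionOffNodes

/-- The indices of the vanishing orders of the included series among those of the ambient one. -/
theorem exists_indices (hg : g = u * (s + 1)) (hm : (m : ℤ) = s + u * s) (hX : X.IsGeneral)
    (I : InclusionOffNodes X s r₂ m d) (hI : I.ambient.HasWordType (cyclicWord g s)) (j : Fin g) :
    ∃ σ τ : ℕ → ℕ, (∀ i ≤ r₂, σ i ≤ s ∧
      ((I.included.aspect j).van (X.p j) i : ℤ) = cyclicOrder s j (σ i)) ∧
      ∀ i ≤ r₂, τ i ≤ s ∧
        ((I.included.aspect j).van (X.q j) (r₂ - i) : ℤ) = m - cyclicOrder s (j + 1) (τ i) := by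
  have hF := X.isFunctionField j
  have hσ : ∀ i, ∃ k, i ≤ r₂ → k ≤ s ∧
      ((I.included.aspect j).van (X.p j) i : ℤ) = cyclicOrder s j k := by
    intro i
    by_cases hi : i ≤ r₂
    · obtain ⟨k, hk, h⟩ := (I.ambient.aspect j).exists_van_eq hF (X.p j)
        (((I.included.aspect j).isVanishingOrder_van hF (X.p j) hi).mono
          (I.same_bundle j) (I.le_ambient j))
      exact ⟨k, fun _ => ⟨hk, by rw [← h, I.ambient.van_p_eq hg hm hX hI j hk]⟩⟩
    · exact ⟨0, fun h => absurd h hi⟩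
  have hτ : ∀ i, ∃ k, i ≤ r₂ → k ≤ s ∧
      ((I.included.aspect j).van (X.q j) (r₂ - i) : ℤ) = m - cyclicOrder s (j + 1) k := by
    intro i
    obtain ⟨k, hk, h⟩ := (I.ambient.aspect j).exists_van_eq hF (X.q j)
      (((I.included.aspect j).isVanishingOrder_van hF (X.q j) (Nat.sub_le r₂ i)).mono
        (I.same_bundle j) (I.le_ambient j))
    -- Orders at `q` are indexed in reverse, so the `k`-th of them belongs to the index `s - k`.
    refine ⟨s - k, fun _ => ⟨Nat.sub_le s k, ?_⟩⟩
    have h1 := I.ambient.van_q_eq hg hm hX hI j (Nat.sub_le s k)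
    rw [Nat.sub_sub_self hk] at h1
    rw [← h, h1]
  choose σ hσ using hσ
  choose τ hτ using hτ
  exact ⟨σ, τ, hσ, hτ⟩

/-- The geometric inputs of `le_sum_shift`: the degree bound with `D'`, and uniqueness of the index
attaining it since `p - q` is nontorsion. -/
theorem le_sum_indices (hg : g = u * (s + 1)) (hm : (m : ℤ) = s + u * s) (hX : X.IsGeneral)
    (I : InclusionOffNodes X s r₂ m d) (hI : I.ambient.HasWordType (cyclicWord g s)) (j : Fin g)
    {σ τ : ℕ → ℕ} (hσ : ∀ i ≤ r₂, σ i ≤ s ∧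
      ((I.included.aspect j).van (X.p j) i : ℤ) = cyclicOrder s j (σ i))
    (hτ : ∀ i ≤ r₂, τ i ≤ s ∧
      ((I.included.aspect j).van (X.q j) (r₂ - i) : ℤ) = m - cyclicOrder s (j + 1) (τ i))
    {D' : CurveDivisor K (F j)} (hD'0 : 0 ≤ D') (hD' : D' ≤ I.base j) (hp : D' (X.p j) = 0)
    (hq : D' (X.q j) = 0) {e : ℕ} (he : D'.degree = e) :
    (r₂ * e + (if 2 ≤ e then 1 else 0) : ℤ) ≤
      ∑ i ∈ Finset.range (r₂ + 1), ((τ i : ℤ) - σ i) := by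
  have hF := X.isFunctionField j
  set S := I.included.aspect j with hS
  have hvan : ∀ i ≤ r₂, ∀ k ≤ r₂, S.van (X.p j) i = S.van (X.p j) k → i = k := by
    intro i hi k hk hik
    rcases lt_trichotomy i k with h | h | h
    · have := S.van_lt_van hF (X.p j) h hk
      omega
    · exact h
    · have := S.van_lt_van hF (X.p j) h hi
      omega
  have hprin : ∀ i ≤ r₂, cyclicOrder s j (σ i) + e = cyclicOrder s (j + 1) (τ i) →
      CurveDivisor.IsPrincipal (Finsupp.single (X.p j) (S.van (X.p j) i : ℤ) +
        Finsupp.single (X.q j) (S.van (X.q j) (r₂ - i) : ℤ) + (D' - S.A) :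
          CurveDivisor K (F j)) := fun i hi h =>
    S.isPrincipal_of_van_add_van hF (X.p j) (X.p_ne_q j) (I.vanishes_on_base j) hD' hp hq hi (by
      rw [(hσ i hi).2, (hτ i hi).2, he]
      linarith)
  refine le_sum_shift (s := s) (j := j) (fun i hi => (hσ i hi).1) (fun i hi => (hτ i hi).1)
    (fun i hi k hk hik => hvan i hi k hk ?_) (fun i hi => ?_) (fun i hi k hk h1 h2 => ?_)
    (fun he0 i hi h => ?_)
  · have h1 := (hσ i hi).2
    have h2 := (hσ k hk).2
    rw [hik] at h1
    exact_mod_cast h1.trans h2.symm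
  · have h1 := S.van_add_van_add_degree_le hF (X.p j) (X.p_ne_q j) (I.vanishes_on_base j) hD' hp hq
      hi
    rw [(hσ i hi).2, (hτ i hi).2, he] at h1
    linarith
  · refine hvan i hi k hk ?_
    have h3 := CurveDivisor.eq_of_isPrincipal (hX j) (by
      rw [(hσ i hi).2, (hτ i hi).2, (hσ k hk).2, (hτ k hk).2]
      linarith) (hprin i hi h1) (hprin k hk h2)
    exact_mod_cast h3
  · subst he0
    obtain rfl := CurveDivisor.eq_zero_of_degree_eq_zero hD'0 (by simpa using he)
    have hA := I.same_bundle j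
    have h1 := hprin i hi h
    have hc : (j : ℕ) % (s + 1) ≤ s := Nat.lt_add_one_iff.1 (Nat.mod_lt _ (Nat.add_one_pos s))
    have hword : ((I.ambient.aspect j).van (X.p j) ((j : ℕ) % (s + 1)) : ℤ) +
        (I.ambient.aspect j).van (X.q j) (s - (j : ℕ) % (s + 1)) = m := by
      exact_mod_cast hI j
    -- With `D' = 0` the included and ambient series share the bundle `A`, so equality must occur at
    -- the order named by the letter.
    have h2 := (I.ambient.aspect j).isPrincipal_of_van_add_van hF (X.p j) (X.p_ne_q j)
      (D := 0) (D' := 0) (by rw [sub_zero]; exact (I.ambient.aspect j).le_sections) le_rfl rfl rfl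
      hc (by
        rw [hword]
        simp [CurveDivisor.degree])
    rw [← hA] at h2
    have h3 := CurveDivisor.eq_of_isPrincipal (hX j) (by
      rw [hword, (hσ i hi).2, (hτ i hi).2]
      push_cast at h
      linarith) h1 h2
    rw [(hσ i hi).2, I.ambient.van_p_eq hg hm hX hI j hc] at h3
    exact cyclicOrder_inj h3

/-- Here the telescoped upper bound meets the sum of the local lower bounds; `hd` says that they
agree up to the nonnegative excess terms. -/
theorem degree_base_le_one (hg : g = u * (s + 1)) (hu : 1 ≤ u) (hm : (m : ℤ) = s + u * s)
    (hd : (r₂ + 1) * ((s : ℤ) - r₂) = r₂ * d) (hX : X.IsGeneral)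
    (I : InclusionOffNodes X s r₂ m d) (hI : I.ambient.HasWordType (cyclicWord g s)) (j : Fin g) :
    (I.base j).degree ≤ 1 := by
  have hgpos : 0 < g := by
    rw [hg]
    positivity
  choose σ τ hσ hτ using fun j => I.exists_indices hg hm hX hI j
  choose D' hD'0 hD' hp hq hdeg using fun j =>
    CurveDivisor.exists_off_points (I.base_effective j) (X.p_ne_q j)
  choose e he using fun j => Int.eq_ofNat_of_zero_le (CurveDivisor.degree_nonneg (hD'0 j))
  let j₀ : Fin g := ⟨0, hgpos⟩
  let j₁ : Fin g := ⟨g - 1, by omega⟩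
  -- The first `p` and the last `q` are not nodes, so base points may lie there; each raises all
  -- orders at that end.
  set x := I.base j₀ (X.p j₀) with hx
  set y := I.base j₁ (X.q j₁) with hy
  have hx0 : 0 ≤ x := I.base_effective j₀ (X.p j₀)
  have hy0 : 0 ≤ y := I.base_effective j₁ (X.q j₁)
  have hbp : ∀ j, j ≠ j₀ → I.base j (X.p j) = 0 := fun j hj =>
    I.base_off_nodes j _ (Or.inl ⟨Nat.pos_of_ne_zero fun h => hj (Fin.ext h), rfl⟩)
  have hbq : ∀ j, j ≠ j₁ → I.base j (X.q j) = 0 := fun j hj =>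
    I.base_off_nodes j _ (Or.inr ⟨by
      have h1 : (j : ℕ) ≠ g - 1 := fun h => hj (Fin.ext h)
      omega, rfl⟩)
  have htotal : (d : ℤ) = ∑ j, (e j : ℤ) + x + y := by
    have h1 := I.base_degree
    simp only [hdeg, he, Finset.sum_add_distrib] at h1
    rw [Finset.sum_eq_single j₀ (fun j _ hj => hbp j hj) (by simp),
      Finset.sum_eq_single j₁ (fun j _ hj => hbq j hj) (by simp)] at h1
    exact h1.symm
  have hσ₀ : ∀ i ≤ r₂, (i : ℤ) + x ≤ σ j₀ i := by
    intro i hi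
    have hF := X.isFunctionField j₀
    have h1 := LinearSeries.le_of_isVanishingOrder (I.vanishes_on_base j₀)
      ((I.included.aspect j₀).isVanishingOrder_van hF (X.p j₀) (Nat.zero_le _))
    have h2 := (I.included.aspect j₀).le_van hF (X.p j₀) (x := x.toNat) (by omega) hi
    have h3 := (hσ j₀ i hi).2
    rw [cyclicOrder_zero] at h3
    omega
  have hτ₁ : ∀ i ≤ r₂, (τ j₁ i : ℤ) ≤ s - r₂ + i - y := by
    intro i hi
    have hF := X.isFunctionField j₁
    have h1 := LinearSeries.le_of_isVanishingOrder (I.vanishes_on_base j₁)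
      ((I.included.aspect j₁).isVanishingOrder_van hF (X.q j₁) (Nat.zero_le _))
    have h2 := (I.included.aspect j₁).le_van hF (X.q j₁) (x := y.toNat) (by omega)
      (Nat.sub_le r₂ i)
    have h3 := (hτ j₁ i hi).2
    have h4 : (j₁ : ℕ) + 1 = u * (s + 1) := by
      rw [← hg]
      exact Nat.sub_add_cancel hgpos
    rw [h4, cyclicOrder_mul] at h3
    omega
  have hstep : ∀ j j' : Fin g, (j' : ℕ) = j + 1 →
      ∑ i ∈ Finset.range (r₂ + 1), (τ j i : ℤ) ≤ ∑ i ∈ Finset.range (r₂ + 1), (σ j' i : ℤ) := by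
    intro j j' hj
    refine Finset.sum_le_sum fun i hi => ?_
    have hir : i ≤ r₂ := Nat.lt_add_one_iff.1 (Finset.mem_range.1 hi)
    have h1 := I.included.compatible j j' hj i hir
    have h2 := (hτ j i hir).2
    have h3 := (hσ j' i hir).2
    rw [hj] at h3
    have h4 : cyclicOrder s (j + 1) (τ j i) ≤ cyclicOrder s (j + 1) (σ j' i) := by omega
    exact_mod_cast cyclicOrder_le_iff.1 h4
  have hupper := sum_sub_le_of_le_succ _ _ hstep j₀ j₁ rfl (Nat.sub_add_cancel hgpos)
  have hends : ∑ i ∈ Finset.range (r₂ + 1), (τ j₁ i : ℤ) -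
      ∑ i ∈ Finset.range (r₂ + 1), (σ j₀ i : ℤ) ≤ (r₂ + 1) * ((s : ℤ) - r₂ - y - x) := by
    rw [← Finset.sum_sub_distrib]
    calc _ ≤ ∑ i ∈ Finset.range (r₂ + 1), ((s : ℤ) - r₂ - y - x) :=
          Finset.sum_le_sum fun i hi => by
            have hir : i ≤ r₂ := Nat.lt_add_one_iff.1 (Finset.mem_range.1 hi)
            have h1 := hσ₀ i hir
            have h2 := hτ₁ i hir
            omega
      _ = _ := by simp; ring
  have hlower := Finset.sum_le_sum fun j (_ : j ∈ Finset.univ) =>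
    I.le_sum_indices hg hm hX hI j (hσ j) (hτ j) (hD'0 j) (hD' j) (hp j) (hq j) (he j)
  simp only [Finset.sum_sub_distrib] at hlower hupper
  rw [Finset.sum_add_distrib, ← Finset.mul_sum] at hlower
  have hexcess : (if 2 ≤ e j then 1 else 0 : ℤ) ≤ ∑ j, if 2 ≤ e j then 1 else 0 :=
    Finset.single_le_sum (f := fun j => (if 2 ≤ e j then 1 else 0 : ℤ))
      (fun j _ => by positivity) (Finset.mem_univ j)
  -- The ends cost `(r₂ + 1)(x + y)` in the upper bound but carry only `r₂ (x + y)` of the budget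
  -- `r₂ d`, which leaves the term `x + y`.
  have hkey : (if 2 ≤ e j then 1 else 0 : ℤ) + x + y ≤ 0 := by
    have h1 : (r₂ : ℤ) * d = r₂ * ∑ j, (e j : ℤ) + r₂ * x + r₂ * y := by
      rw [htotal]
      ring
    linarith
  have hx1 : I.base j (X.p j) = 0 := by
    by_cases hj : j = j₀
    · subst hj
      split_ifs at hkey <;> omega
    · exact hbp j hj
  have hy1 : I.base j (X.q j) = 0 := by
    by_cases hj : j = j₁
    · subst hj
      split_ifs at hkey <;> omega
    · exact hbq j hj
  rw [hdeg, he, hx1, hy1]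
  split_ifs at hkey <;> omega

end InclusionOffNodes

end Inclusion

end SecantChain

end

/-- Let `X` be a general chain of `g = u(s+1)` elliptic curves and `ρ(g,s,m) = 0`, `μ = 0`. In an
inclusion `g^{s-d+r}_{m-d} + p_1 + ⋯ + p_d ↪ g^s_m` of limit linear series on `X` without base points
at the points of attachment, whose ambient series has word type `(12⋯(s+1))^u`, at most one of the
base points, and this one simple, lies on each component. -/
theorem mainTheorem7 {K : Type*} [Field K] [IsAlgClosed K]
    (g s m d r r₂ u : ℕ) (hg : g = u * (s + 1)) (hu : 1 ≤ u)
    (hr₂ : (r₂ : ℤ) = (s : ℤ) - d + r) (hr₂s : r₂ < s) (hd : 1 ≤ d)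
    (hrho : SecantChain.rho g s m = 0) (hmu : SecantChain.mu d r s = 0)
    (F : Fin g → Type*) [∀ j, Field (F j)] [∀ j, Algebra K (F j)]
    (X : SecantChain.EllipticChain K F) (hX : X.IsGeneral)
    (I : SecantChain.InclusionOffNodes X s r₂ m d)
    (hword : I.ambient.HasWordType (SecantChain.cyclicWord g s)) :
    ∀ j : Fin g, I.base j = 0 ∨
      ∃ P : SecantChain.Place K (F j), I.base j = Finsupp.single P 1 := by
  have hm : (m : ℤ) = s + u * s := by
    simp only [SecantChain.rho, hg] at hrho
    push_cast at hrho
    have h1 : ((s : ℤ) + 1) * (u - (s + (u * (s + 1)) - m)) = 0 := by linarith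
    have h2 := (mul_eq_zero.1 h1).resolve_left (by positivity)
    linarith
  -- From `μ = 0`: `d = r (r₂ + 1)`, hence `s - r₂ = d - r = r r₂`.
  have hd' : ((r₂ : ℤ) + 1) * ((s : ℤ) - r₂) = r₂ * d := by
    simp only [SecantChain.mu] at hmu
    have h1 : (d : ℤ) = r * (r₂ + 1) := by
      rw [hr₂]
      linarith
    have h2 : (s : ℤ) - r₂ = r * r₂ := by linarith
    rw [h2, h1]
    ring
  exact fun j => SecantChain.CurveDivisor.eq_zero_or_eq_single (I.base_effective j)
    (I.degree_base_le_one hg hu hm hd' hX hword j)
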